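/- A $k$-flat of $\mathbb{R}^d$ is a linear subspace of dimension $k$. For points $P=(p_1,\dots,p_n)$ in $\mathbb{R}^d$ and a flat $F$ put $\mathrm{Price}(P,F)=\sum_{i=1}^n \mathrm{dist}(p_i,F)^2$, where $\mathrm{dist}$ is the Euclidean distance, and let $\mathrm{Opt}_k(P)$ be the minimum of $\mathrm{Price}(P,H)$ over all $k$-flats $H$. Let $N=nd$ be the size of the input. The model of computation is a randomized real RAM: exact arithmetic ($+,-,\times,/,\sqrt{\ }$) and comparisons of real numbers, arithmetic and comparisons of indices, indexed memory access, and drawing an independent uniform random number from $[0,1]$ cost $O(1)$ each, and, as is customary, the exact singular value decomposition of an $a\times b$ matrix costs $O(ab\min(a,b))$. Lemma. There is a randomized algorithm with the following property. Its input consists of integers $n\ge 1$ and $1\le k\le d$, points $P=(p_1,\dots,p_n)$ in $\mathbb{R}^d$, a basis of an $O(k)$-flat $F\subseteq\mathbb{R}^d$ (that is, $\dim F\le c\,k$ for a constant $c$), and real parameters $\varepsilon>0$ and $\delta>0$. It always returns $k$ vectors that span a $k$-flat $H$, and, with probability at least $1-\delta$, $$\mathrm{Price}(P,H)\;\le\;\Bigl(1+\frac{\varepsilon}{2}\Bigr)\mathrm{Opt}_k(P)+\frac{\varepsilon}{2}\,\mathrm{Price}(P,F).$$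 For $\varepsilon\le 1$ and $\delta\le 1/2$ its running time is $O\bigl(N\,\frac{k}{\varepsilon}\,\log\frac1\delta\bigr)$, where the constant depends only on $c$; for arbitrary $\varepsilon,\delta>0$ the same bound holds with $\varepsilon$ and $\delta$ replaced by $\min(\varepsilon,1)$ and $\min(\delta,1/2)$. -/

import Mathlib

open MeasureTheory
open scoped Matrix

/-! ### Flats, distances and prices -/

/-- A `k`-flat of `ℝ^d`: a linear subspace of dimension `k`. -/
def IsFlat {d : ℕ} (k : ℕ) (F : Submodule ℝ (EuclideanSpace ℝ (Fin d))) : Prop :=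
  Module.finrank ℝ F = k

/-- The price of fitting the points `P 0, …, P (n-1)` to the flat `F`: the sum of the squared
Euclidean distances of the points to `F`. -/
noncomputable def price {n d : ℕ} (P : Fin n → EuclideanSpace ℝ (Fin d))
    (F : Submodule ℝ (EuclideanSpace ℝ (Fin d))) : ℝ :=
  ∑ i, (Metric.infDist (P i) (F : Set (EuclideanSpace ℝ (Fin d)))) ^ 2

/-- The optimal price of fitting the points to a `k`-flat. -/
noncomputable def optPrice {n d : ℕ} (P : Fin n → EuclideanSpace ℝ (Fin d)) (k : ℕ) : ℝ :=
  sInf (price P '' {F | IsFlat k F})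

/-! ### The singular value decomposition -/

/-- `M = U · diag σ · Vᵀ` is a (thin) singular value decomposition of `M`: the columns of `U` and
the columns of `V` are orthonormal, and the singular values `σ` are nonnegative and listed in
decreasing order. For an `a × b` matrix it is used with `q = min a b`. -/
structure IsThinSVD {a b q : ℕ} (M : Matrix (Fin a) (Fin b) ℝ) (U : Matrix (Fin a) (Fin q) ℝ)
    (σ : Fin q → ℝ) (V : Matrix (Fin b) (Fin q) ℝ) : Prop where
  left_orthonormal : Uᵀ * U = 1
  right_orthonormal : Vᵀ * V = 1
  nonneg : ∀ i, 0 ≤ σ i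
  antitone : Antitone σ
  eq_mul : M = U * Matrix.diagonal σ * Vᵀ

theorem exists_isThinSVD_of_le {a b : ℕ} (hab : b ≤ a) (M : Matrix (Fin a) (Fin b) ℝ) :
    ∃ (U : Matrix (Fin a) (Fin b) ℝ) (σ : Fin b → ℝ) (V : Matrix (Fin b) (Fin b) ℝ),
      IsThinSVD M U σ V := by
  classical
  set T := Matrix.toEuclideanLin M with hT
  have hS := T.isSymmetric_adjoint_comp_self
  have hn : Module.finrank ℝ (EuclideanSpace ℝ (Fin b)) = b := by simp
  set v := hS.eigenvectorBasis hn with hv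
  set l := hS.eigenvalues hn with hl
  have hin : ∀ i j, inner ℝ (T (v i)) (T (v j)) = if i = j then l j else 0 := by
    intro i j
    rw [← LinearMap.adjoint_inner_right]
    have h1 := hS.apply_eigenvectorBasis hn j
    rw [LinearMap.comp_apply] at h1
    rw [h1, inner_smul_right, orthonormal_iff_ite.mp v.orthonormal i j]
    split_ifs <;> simp [hl]
  have hl0 : ∀ i, 0 ≤ l i := by
    intro i
    have := hin i i
    rw [if_pos rfl] at this
    rw [← this]
    exact real_inner_self_nonneg
  set w : Fin a → EuclideanSpace ℝ (Fin a) :=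
    fun j => if h : j.1 < b then (√(l ⟨j, h⟩))⁻¹ • T (v ⟨j, h⟩) else 0 with hw
  set s : Set (Fin a) := {j | ∃ h : j.1 < b, 0 < l ⟨j, h⟩} with hs
  have hor : Orthonormal ℝ (s.domRestrict w) := by
    rw [orthonormal_iff_ite]
    rintro ⟨i, hi, hi'⟩ ⟨j, hj, hj'⟩
    have e1 : s.domRestrict w ⟨i, hi, hi'⟩ = (√(l ⟨i, hi⟩))⁻¹ • T (v ⟨i, hi⟩) := by
      simp [hw, hi]
    have e2 : s.domRestrict w ⟨j, hj, hj'⟩ = (√(l ⟨j, hj⟩))⁻¹ • T (v ⟨j, hj⟩) := by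
      simp [hw, hj]
    rw [e1, e2, inner_smul_left, inner_smul_right, hin]
    by_cases hij : i = j
    · subst hij
      have h3 : √(l ⟨i, hi⟩) ≠ 0 := (Real.sqrt_pos.mpr hi').ne'
      have h4 := Real.mul_self_sqrt (hl0 ⟨i, hi⟩)
      simp only [if_true, conj_trivial]
      field_simp
      rw [sq, h4]
    · have : ¬ ((⟨i, hi⟩ : Fin b) = ⟨j, hj⟩) := by
        intro h
        exact hij (Fin.ext (by simpa using h))
      simp [this, hij]
  obtain ⟨e, he⟩ := hor.exists_orthonormalBasis_extension_of_card_eq (by simp)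
  have hTv : ∀ i : Fin b, T (v i) = √(l i) • e (Fin.castLE hab i) := by
    intro i
    rcases (hl0 i).lt_or_eq with h | h
    · rw [he _ ⟨i.2, h⟩]
      have h3 : √(l i) ≠ 0 := (Real.sqrt_pos.mpr h).ne'
      simp [hw, smul_smul, h3]
    · have h5 := hin i i
      rw [if_pos rfl, ← h, inner_self_eq_zero] at h5
      rw [h5, ← h]
      simp
  refine ⟨Matrix.of fun i j => e (Fin.castLE hab j) i, fun i => √(l i),
    Matrix.of fun i j => v j i, ?_, ?_, ?_, ?_, ?_⟩
  · ext i j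
    have := orthonormal_iff_ite.mp e.orthonormal (Fin.castLE hab i) (Fin.castLE hab j)
    simp only [PiLp.inner_apply, RCLike.inner_apply, conj_trivial] at this
    rw [Matrix.mul_apply, Matrix.one_apply]
    simp only [Matrix.transpose_apply, Matrix.of_apply]
    simp only [Fin.castLE_inj] at this
    rw [← this]
    exact Finset.sum_congr rfl fun x _ => mul_comm _ _
  · ext i j
    have := orthonormal_iff_ite.mp v.orthonormal i j
    simp only [PiLp.inner_apply, RCLike.inner_apply, conj_trivial] at this
    rw [Matrix.mul_apply, Matrix.one_apply]
    simp only [Matrix.transpose_apply, Matrix.of_apply]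
    rw [← this]
    exact Finset.sum_congr rfl fun x _ => mul_comm _ _
  · exact fun i => Real.sqrt_nonneg _
  · exact fun i j hij => Real.sqrt_le_sqrt (hS.eigenvalues_antitone hn hij)
  · have key : ∀ x, T x = ∑ j, (√(l j) * inner ℝ (v j) x) • e (Fin.castLE hab j) := by
      intro x
      conv_lhs => rw [← v.sum_repr' x]
      rw [map_sum]
      refine Finset.sum_congr rfl fun j _ => ?_
      rw [map_smul, hTv, smul_smul, mul_comm]
    ext i j
    have h := congrArg (fun y : EuclideanSpace ℝ (Fin a) => y i) (key (EuclideanSpace.single j 1))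
    simp only [hT, Matrix.toLpLin_apply, WithLp.ofLp_sum, Finset.sum_apply, PiLp.smul_apply,
      smul_eq_mul] at h
    rw [Matrix.mul_apply]
    simp only [Matrix.mul_diagonal, Matrix.transpose_apply, Matrix.of_apply]
    have h6 : ∀ y : Fin b, inner ℝ (v y) (EuclideanSpace.single j (1 : ℝ)) = v y j := by
      intro y
      rw [EuclideanSpace.inner_single_right]
      simp
    simp only [h6] at h
    have h7 : (M *ᵥ (EuclideanSpace.single j (1 : ℝ)).ofLp) i = M i j := by simp
    rw [h7] at h
    rw [h]
    exact Finset.sum_congr rfl fun y _ => by ring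

theorem IsThinSVD.transpose {a b q : ℕ} {M : Matrix (Fin a) (Fin b) ℝ}
    {U : Matrix (Fin a) (Fin q) ℝ} {σ : Fin q → ℝ} {V : Matrix (Fin b) (Fin q) ℝ}
    (h : IsThinSVD M U σ V) : IsThinSVD Mᵀ V σ U where
  left_orthonormal := h.right_orthonormal
  right_orthonormal := h.left_orthonormal
  nonneg := h.nonneg
  antitone := h.antitone
  eq_mul := by
    conv_lhs => rw [h.eq_mul]
    simp [Matrix.transpose_mul, Matrix.mul_assoc]

/-- Every real matrix has a singular value decomposition. -/
theorem exists_isThinSVD {a b : ℕ} (M : Matrix (Fin a) (Fin b) ℝ) :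
    ∃ x : Matrix (Fin a) (Fin (min a b)) ℝ × (Fin (min a b) → ℝ) ×
      Matrix (Fin b) (Fin (min a b)) ℝ, IsThinSVD M x.1 x.2.1 x.2.2 := by
  suffices H : ∀ q, q = min a b → ∃ x : Matrix (Fin a) (Fin q) ℝ × (Fin q → ℝ) ×
      Matrix (Fin b) (Fin q) ℝ, IsThinSVD M x.1 x.2.1 x.2.2 from H _ rfl
  rintro q hq
  rcases le_total b a with h | h
  · obtain rfl : q = b := by omega
    obtain ⟨U, σ, V, hx⟩ := exists_isThinSVD_of_le h M
    exact ⟨(U, σ, V), hx⟩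
  · obtain rfl : q = a := by omega
    obtain ⟨U, σ, V, hx⟩ := exists_isThinSVD_of_le h Mᵀ
    exact ⟨(V, σ, U), by simpa using hx.transpose⟩

/-- A singular value decomposition `(U, σ, V)` of the matrix `M`. -/
noncomputable def thinSVD {a b : ℕ} (M : Matrix (Fin a) (Fin b) ℝ) :
    Matrix (Fin a) (Fin (min a b)) ℝ × (Fin (min a b) → ℝ) × Matrix (Fin b) (Fin (min a b)) ℝ :=
  (exists_isThinSVD M).choose

theorem thinSVD_spec {a b : ℕ} (M : Matrix (Fin a) (Fin b) ℝ) :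
    IsThinSVD M (thinSVD M).1 (thinSVD M).2.1 (thinSVD M).2.2 :=
  (exists_isThinSVD M).choose_spec

/-! ### A randomized real RAM with a step count

The machine has registers holding natural numbers (sizes and indices) and an unbounded supply of
two-dimensional arrays of real numbers, whose entries are addressed by computed indices. The
operations are exact: arithmetic and comparisons of index values, arithmetic, square roots and
comparisons of reals, all of unit cost, drawing an independent uniform random number from `[0,1]`,
of unit cost, and the singular value decomposition of an `a × b` matrix at its customary cost
`O(a b min(a,b))`. A real number is never converted into an index. -/

/-- Index expressions. -/
inductive NExpr where
  | const (m : ℕ)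
  | reg (x : ℕ)
  | add (e₁ e₂ : NExpr)
  | sub (e₁ e₂ : NExpr)
  | mul (e₁ e₂ : NExpr)

/-- Real expressions. `entry A i j` is the entry `(i, j)` of the array number `A`. -/
inductive RExpr where
  | ofIndex (e : NExpr)
  | entry (A : ℕ) (i j : NExpr)
  | add (e₁ e₂ : RExpr)
  | sub (e₁ e₂ : RExpr)
  | mul (e₁ e₂ : RExpr)
  | div (e₁ e₂ : RExpr)
  | sqrt (e : RExpr)

/-- Tests: comparisons of two index values or of two real values. -/
inductive Test where
  | nlt (e₁ e₂ : NExpr)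
  | rlt (e₁ e₂ : RExpr)

/-- Programs.
* `setReg x e` stores the value of `e` in the index register `x`;
* `setEntry A i j e` stores the value of `e` in the entry `(i, j)` of the array `A`;
* `draw A i j` stores a fresh random number there;
* `svd A a b U S V` decomposes the upper left `a × b` block of the array `A`, and stores the left
  singular vectors as the columns of the array `U`, the singular values in the first row of the
  array `S`, and the right singular vectors as the columns of the array `V`. -/
inductive Prog where
  | skip
  | setReg (x : ℕ) (e : NExpr)
  | setEntry (A : ℕ) (i j : NExpr) (e : RExpr)
  | draw (A : ℕ) (i j : NExpr)
  | svd (A : ℕ) (a b : NExpr) (U S V : ℕ)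
  | seq (p₁ p₂ : Prog)
  | ite (t : Test) (p₁ p₂ : Prog)
  | while (t : Test) (p : Prog)

/-- A memory configuration: the index registers, the real arrays, and the number of random numbers
drawn so far. -/
structure Config where
  reg : ℕ → ℕ
  arr : ℕ → ℕ → ℕ → ℝ
  drawn : ℕ

/-- The sources of randomness: infinite sequences of numbers from `[0,1]`. -/
abbrev Tape := ℕ → unitInterval

/-- The law of the source of randomness: independent uniform numbers. -/
noncomputable def tapeMeasure : Measure Tape :=
  Measure.infinitePi fun _ => (volume : Measure unitInterval)

namespace NExpr

def eval (s : Config) : NExpr → ℕ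
  | const m => m
  | reg x => s.reg x
  | add e₁ e₂ => e₁.eval s + e₂.eval s
  | sub e₁ e₂ => e₁.eval s - e₂.eval s
  | mul e₁ e₂ => e₁.eval s * e₂.eval s

/-- The number of steps of an evaluation: one per node. -/
def cost : NExpr → ℕ
  | const _ => 1
  | reg _ => 1
  | add e₁ e₂ => e₁.cost + e₂.cost + 1
  | sub e₁ e₂ => e₁.cost + e₂.cost + 1
  | mul e₁ e₂ => e₁.cost + e₂.cost + 1

end NExpr

namespace RExpr

noncomputable def eval (s : Config) : RExpr → ℝ
  | ofIndex e => (e.eval s : ℝ)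
  | entry A i j => s.arr A (i.eval s) (j.eval s)
  | add e₁ e₂ => e₁.eval s + e₂.eval s
  | sub e₁ e₂ => e₁.eval s - e₂.eval s
  | mul e₁ e₂ => e₁.eval s * e₂.eval s
  | div e₁ e₂ => e₁.eval s / e₂.eval s
  | sqrt e => √(e.eval s)

def cost : RExpr → ℕ
  | ofIndex e => e.cost + 1
  | entry _ i j => i.cost + j.cost + 1
  | add e₁ e₂ => e₁.cost + e₂.cost + 1
  | sub e₁ e₂ => e₁.cost + e₂.cost + 1
  | mul e₁ e₂ => e₁.cost + e₂.cost + 1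
  | div e₁ e₂ => e₁.cost + e₂.cost + 1
  | sqrt e => e.cost + 1

end RExpr

namespace Test

def Holds (s : Config) : Test → Prop
  | nlt e₁ e₂ => e₁.eval s < e₂.eval s
  | rlt e₁ e₂ => e₁.eval s < e₂.eval s

def cost : Test → ℕ
  | nlt e₁ e₂ => e₁.cost + e₂.cost + 1
  | rlt e₁ e₂ => e₁.cost + e₂.cost + 1

end Test

/-- Store the matrix `M` in the upper left block of the array number `A`. -/
noncomputable def putMatrix (arr : ℕ → ℕ → ℕ → ℝ) (A : ℕ) {a b : ℕ}
    (M : Matrix (Fin a) (Fin b) ℝ) : ℕ → ℕ → ℕ → ℝ :=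
  fun B i j => if h : B = A ∧ i < a ∧ j < b then M ⟨i, h.2.1⟩ ⟨j, h.2.2⟩ else arr B i j

/-- The upper left `a × b` block of the array number `A`. -/
def getMatrix (arr : ℕ → ℕ → ℕ → ℝ) (A a b : ℕ) : Matrix (Fin a) (Fin b) ℝ :=
  Matrix.of fun i j => arr A i j

namespace Config

def setReg (s : Config) (x v : ℕ) : Config :=
  { s with reg := Function.update s.reg x v }

noncomputable def setEntry (s : Config) (A i j : ℕ) (v : ℝ) : Config :=
  { s with arr := fun B i' j' => if B = A ∧ i' = i ∧ j' = j then v else s.arr B i' j' }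

noncomputable def svd (s : Config) (A a b U S V : ℕ) : Config :=
  let x := thinSVD (getMatrix s.arr A a b)
  { s with
    arr := putMatrix (putMatrix (putMatrix s.arr U x.1) S
      (Matrix.of fun (_ : Fin 1) j => x.2.1 j)) V x.2.2 }

end Config

/-- `Exec ω p s T s'`: when the source of randomness is `ω`, the program `p`, started in the
configuration `s`, halts after exactly `T` steps in the configuration `s'`. -/
inductive Exec (ω : Tape) : Prog → Config → ℕ → Config → Prop
  | skip (s) : Exec ω .skip s 1 s
  | setReg (s x e) : Exec ω (.setReg x e) s (e.cost + 1) (s.setReg x (e.eval s))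
  | setEntry (s A i j e) : Exec ω (.setEntry A i j e) s (i.cost + j.cost + e.cost + 1)
      (s.setEntry A (i.eval s) (j.eval s) (e.eval s))
  | draw (s A i j) : Exec ω (.draw A i j) s (i.cost + j.cost + 1)
      { s.setEntry A (i.eval s) (j.eval s) (ω s.drawn : ℝ) with drawn := s.drawn + 1 }
  | svd (s A a b U S V) : Exec ω (.svd A a b U S V) s
      (a.cost + b.cost + a.eval s * b.eval s * min (a.eval s) (b.eval s) + 1)
      (s.svd A (a.eval s) (b.eval s) U S V)
  | seq {p₁ p₂ s₁ s₂ s₃ T₁ T₂} (h₁ : Exec ω p₁ s₁ T₁ s₂) (h₂ : Exec ω p₂ s₂ T₂ s₃) :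
      Exec ω (.seq p₁ p₂) s₁ (T₁ + T₂) s₃
  | ite_true {t p₁ p₂ s s' T} (ht : t.Holds s) (h : Exec ω p₁ s T s') :
      Exec ω (.ite t p₁ p₂) s (t.cost + T) s'
  | ite_false {t p₁ p₂ s s' T} (ht : ¬ t.Holds s) (h : Exec ω p₂ s T s') :
      Exec ω (.ite t p₁ p₂) s (t.cost + T) s'
  | while_true {t p s₁ s₂ s₃ T₁ T₂} (ht : t.Holds s₁) (h₁ : Exec ω p s₁ T₁ s₂)
      (h₂ : Exec ω (.while t p) s₂ T₂ s₃) : Exec ω (.while t p) s₁ (t.cost + T₁ + T₂) s₃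
  | while_false {t p s} (ht : ¬ t.Holds s) : Exec ω (.while t p) s t.cost s

/-! ### Input and output -/

/-- The initial configuration. The registers `0, 1, 2, 3` hold `n, d, k, u`. The array `0` holds the
points (one per row), the array `1` holds the `u` given vectors (one per row), and the first two
entries of the first row of the array `2` are `ε` and `δ`. All other registers and entries are
zero, and no random numbers have been drawn. -/
noncomputable def inputConfig {n d u : ℕ} (k : ℕ) (P : Fin n → EuclideanSpace ℝ (Fin d))
    (B : Fin u → EuclideanSpace ℝ (Fin d)) (ε δ : ℝ) : Config where
  reg := fun x => if x = 0 then n else if x = 1 then d else if x = 2 then k else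
    if x = 3 then u else 0
  arr := putMatrix (putMatrix (putMatrix (fun _ _ _ => 0) 0 (Matrix.of fun i j => P i j)) 1
    (Matrix.of fun i j => B i j)) 2 !![ε, δ]
  drawn := 0

/-- The subspace of `ℝ^d` returned in a final configuration: the span of the first `k` rows of the
array `3`. -/
def outputFlat (k d : ℕ) (s : Config) : Submodule ℝ (EuclideanSpace ℝ (Fin d)) :=
  Submodule.span ℝ (Set.range fun i : Fin k => WithLp.toLp 2 fun j : Fin d => s.arr 3 i j)

/-! The result is deterministic: the frequent directions sketch gives the factor `1 + ε / 2` on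
every tape. The event in the theorem is thus the whole space, the nonnegative term `ε / 2 * price P
F` is added for free, and `log (1 / min δ (1 / 2)) ≥ 1 / 2` only enlarges the time bound.

Let `A` be the matrix of the points. The price of the span of an orthonormal family `x` is `‖A‖² - ∑
‖A x_j‖²`, with the Frobenius norm, so a good flat is one on which the quadratic form `‖A x‖²` is
large. The sketch `b` has `L` rows and satisfies `‖b x‖² ≤ ‖A x‖² ≤ ‖b x‖² + Δ ‖x‖²`. Each
compression subtracts `σ L ^ 2` from the leading `L` squared singular values. This costs the form at
most `σ L ^ 2` in every unit direction, but lowers the squared Frobenius norm by at least `L * σ L ^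
2`. Summing over all rounds yields `‖b‖² + L Δ ≤ ‖A‖²` (`IsSketch.step`).

Let `w` be an orthonormal basis of a competing flat, and let `x` consist of leading right singular
vectors of `b`, completed if necessary. By the extremal property of singular values, `∑ ‖b w_j‖² ≤ ∑
‖b x_j‖² ≤ ∑ ‖A x_j‖²`, so the price of `x` exceeds that of `w` by at most `k Δ`. Moreover `∑ ‖A
w_j‖² ≤ ‖b‖² + k Δ ≤ ‖A‖² - (L - k) Δ`, that is, `(L - k) Δ` is at most the price of `w`. Hence `2 k
≤ (L - k) ε` suffices (`price_le_of_isSketch`).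

With `L = O(k / ε)` there are about `n / L` decompositions of `2 L × d` matrices, each of cost `O(L²
d)`, in total `O(n d L)`. The completion to `k` vectors by `min n k` reflections costs `O(n d k)`.
-/

/-! ### Prices of flats in terms of orthonormal bases -/

open Finset in
/-- The squared distance to the span of an orthonormal family. -/
theorem infDist_span_sq {E ι : Type*} [NormedAddCommGroup E] [InnerProductSpace ℝ E] [Fintype ι]
    {x : ι → E} (hx : Orthonormal ℝ x) (p : E) :
    Metric.infDist p (Submodule.span ℝ (Set.range x) : Set E) ^ 2 =
      ‖p‖ ^ 2 - ∑ a, (inner ℝ (x a) p) ^ 2 := by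
  classical
  set U := Submodule.span ℝ (Set.range x) with hU
  set y := ∑ a, inner ℝ (x a) p • x a with hy
  have hyU : y ∈ U := Submodule.sum_mem _ fun a _ =>
    Submodule.smul_mem _ _ (Submodule.subset_span ⟨a, rfl⟩)
  have hxy : ∀ a, inner ℝ (x a) y = inner ℝ (x a) p := fun a => by
    rw [hy, hx.inner_right_fintype]
  have hperp : ∀ w ∈ U, inner ℝ (p - y) w = 0 := by
    intro w hw
    induction hw using Submodule.span_induction with
    | mem w hw =>
      obtain ⟨a, rfl⟩ := hw
      rw [real_inner_comm, inner_sub_right, hxy, sub_self]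
    | zero => simp
    | add u v _ _ hu hv => rw [inner_add_right, hu, hv, add_zero]
    | smul r u _ hu => rw [inner_smul_right, hu, mul_zero]
  have hdist : Metric.infDist p (U : Set E) = ‖p - y‖ := by
    refine le_antisymm ?_ ?_
    · rw [← dist_eq_norm]
      exact Metric.infDist_le_dist_of_mem hyU
    · refine (Metric.le_infDist ⟨y, hyU⟩).2 fun {z} hz => ?_
      rw [dist_eq_norm]
      refine le_of_sq_le_sq ?_ (norm_nonneg _)
      have : p - z = (p - y) + (y - z) := by abel
      rw [this, norm_add_sq_real, hperp _ (U.sub_mem hyU hz)]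
      nlinarith [sq_nonneg ‖y - z‖]
  have hyy : ‖y‖ ^ 2 = ∑ a, (inner ℝ (x a) p) ^ 2 := by
    rw [← real_inner_self_eq_norm_sq]
    conv_lhs => rw [hy, sum_inner]
    refine sum_congr rfl fun a _ => ?_
    rw [real_inner_smul_left, ← hy, hxy, sq]
  have hpy : inner ℝ (p - y) y = 0 := hperp y hyU
  have : ‖p‖ ^ 2 = ‖p - y‖ ^ 2 + ‖y‖ ^ 2 := by
    conv_lhs => rw [← sub_add_cancel p y, norm_add_sq_real, hpy]
    ring
  rw [hdist, ← hyy]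
  linarith

/-- The price of the span of an orthonormal family. -/
theorem price_span {n d : ℕ} {ι : Type*} [Fintype ι] (P : Fin n → EuclideanSpace ℝ (Fin d))
    {x : ι → EuclideanSpace ℝ (Fin d)} (hx : Orthonormal ℝ x) :
    price P (Submodule.span ℝ (Set.range x)) =
      ∑ i, ‖P i‖ ^ 2 - ∑ a, ∑ i, (inner ℝ (P i) (x a)) ^ 2 := by
  rw [price, Finset.sum_comm, ← Finset.sum_sub_distrib]
  refine Finset.sum_congr rfl fun i _ => ?_
  rw [infDist_span_sq hx]
  simp only [real_inner_comm]

/-- Every flat is the span of an orthonormal family. -/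
theorem IsFlat.exists_orthonormal {d k : ℕ} {F : Submodule ℝ (EuclideanSpace ℝ (Fin d))}
    (hF : IsFlat k F) : ∃ w : Fin k → EuclideanSpace ℝ (Fin d),
      Orthonormal ℝ w ∧ Submodule.span ℝ (Set.range w) = F := by
  unfold IsFlat at hF
  subst hF
  refine ⟨fun i => stdOrthonormalBasis ℝ F i,
    (stdOrthonormalBasis ℝ F).orthonormal.comp_linearIsometry F.subtypeₗᵢ, ?_⟩
  have h : (Set.range fun i => ((stdOrthonormalBasis ℝ F i : F) : EuclideanSpace ℝ (Fin d))) =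
      F.subtype '' Set.range (stdOrthonormalBasis ℝ F) := by
    rw [← Set.range_comp]; rfl
  rw [h, Submodule.span_image, ← OrthonormalBasis.coe_toBasis, Module.Basis.span_eq]
  simp

open Finset in
theorem sum_range_ite_lt {L N : ℕ} (h : L ≤ N) (f : ℕ → ℝ) :
    ∑ i ∈ range N, (if i < L then f i else 0) = ∑ i ∈ range L, f i := by
  rw [← sum_filter]
  congr 1
  ext i
  simp only [mem_filter, mem_range]
  omega

/-! ### Singular value decompositions of row families -/

/-- The singular values `σ` and the right singular vectors `v`, both continued by zero, of the
matrix with rows `b 0, …, b (a - 1)`. -/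
structure IsRowSVD {E : Type*} [NormedAddCommGroup E] [InnerProductSpace ℝ E]
    (b : ℕ → E) (a q : ℕ) (σ : ℕ → ℝ) (v : ℕ → E) : Prop where
  orthonormal : ∀ i < q, ∀ j < q, inner ℝ (v i) (v j) = if i = j then (1 : ℝ) else 0
  vec_eq_zero : ∀ i, q ≤ i → v i = 0
  nonneg : ∀ i, 0 ≤ σ i
  antitone : Antitone σ
  val_eq_zero : ∀ i, q ≤ i → σ i = 0
  quad : ∀ x, ∑ i ∈ Finset.range a, (inner ℝ (b i) x) ^ 2 =
    ∑ i ∈ Finset.range q, σ i ^ 2 * (inner ℝ (v i) x) ^ 2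

namespace IsRowSVD

open Finset

variable {E : Type*} [NormedAddCommGroup E] [InnerProductSpace ℝ E]
  {b : ℕ → E} {a q : ℕ} {σ : ℕ → ℝ} {v : ℕ → E}

theorem quad_of_le (h : IsRowSVD b a q σ v) {N : ℕ} (hN : q ≤ N) (x : E) :
    ∑ i ∈ range a, (inner ℝ (b i) x) ^ 2 =
      ∑ i ∈ range N, σ i ^ 2 * (inner ℝ (v i) x) ^ 2 := by
  rw [h.quad]
  refine sum_subset (range_mono hN) fun i _ hi => ?_
  rw [h.val_eq_zero i (by simpa using hi)]
  simp

theorem orthonormal_fin (h : IsRowSVD b a q σ v) : Orthonormal ℝ fun i : Fin q => v i := by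
  rw [orthonormal_iff_ite]
  intro i j
  rw [h.orthonormal i i.2 j j.2]
  simp [Fin.ext_iff]

theorem bessel (h : IsRowSVD b a q σ v) (N : ℕ) (x : E) :
    ∑ i ∈ range N, (inner ℝ (v i) x) ^ 2 ≤ ‖x‖ ^ 2 := by
  have h1 := h.orthonormal_fin.sum_inner_products_le (s := univ) x
  simp only [Real.norm_eq_abs, sq_abs] at h1
  rw [Fin.sum_univ_eq_sum_range (fun i => (inner ℝ (v i) x) ^ 2) q] at h1
  refine le_trans ?_ h1
  refine (sum_le_sum_of_subset_of_nonneg (range_mono (le_max_left N q))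
    fun _ _ _ => sq_nonneg _).trans (le_of_eq (Eq.symm ?_))
  refine sum_subset (range_mono (le_max_right N q)) fun i _ hi => ?_
  rw [h.vec_eq_zero i (by simpa using hi)]
  simp

theorem norm_sq (h : IsRowSVD b a q σ v) {i : ℕ} (hi : i < q) : ‖v i‖ ^ 2 = 1 := by
  rw [← real_inner_self_eq_norm_sq, h.orthonormal i hi i hi, if_pos rfl]

theorem norm_sq_le (h : IsRowSVD b a q σ v) (i : ℕ) : ‖v i‖ ^ 2 ≤ 1 := by
  rcases lt_or_ge i q with hi | hi
  · exact (h.norm_sq hi).le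
  · simp [h.vec_eq_zero i hi]

/-- Both sides are the trace of the quadratic form: sum `quad` over an orthonormal basis of `E`. -/
theorem sum_norm_sq [FiniteDimensional ℝ E] (h : IsRowSVD b a q σ v) :
    ∑ i ∈ range a, ‖b i‖ ^ 2 = ∑ i ∈ range q, σ i ^ 2 := by
  have e := stdOrthonormalBasis ℝ E
  have key : ∀ y : E, ‖y‖ ^ 2 = ∑ j, (inner ℝ y (e j)) ^ 2 := fun y => by
    simpa using (e.sum_sq_norm_inner_left y).symm
  have h1 : ∀ i ∈ range q, σ i ^ 2 = ∑ j, σ i ^ 2 * (inner ℝ (v i) (e j)) ^ 2 := fun i hi => by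
    rw [← mul_sum, ← key, h.norm_sq (by simpa using hi), mul_one]
  rw [sum_congr rfl h1, sum_comm, ← sum_congr rfl fun j _ => h.quad (e j), sum_comm]
  exact sum_congr rfl fun i _ => key _

theorem sum_val_sq_le (h : IsRowSVD b a q σ v) (N : ℕ) :
    ∑ i ∈ range N, σ i ^ 2 ≤ ∑ i ∈ range q, σ i ^ 2 := by
  refine (sum_le_sum_of_subset_of_nonneg (range_mono (le_max_left N q))
    fun _ _ _ => sq_nonneg _).trans (le_of_eq (Eq.symm ?_))
  refine sum_subset (range_mono (le_max_right N q)) fun i _ hi => ?_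
  rw [h.val_eq_zero i (by simpa using hi)]
  simp

theorem val_sq_le (h : IsRowSVD b a q σ v) {i j : ℕ} (hij : i ≤ j) : σ j ^ 2 ≤ σ i ^ 2 :=
  pow_le_pow_left₀ (h.nonneg j) (h.antitone hij) 2

theorem shrink_inner_sq (h : IsRowSVD b a q σ v) {i L : ℕ} (hi : i < L) (x : E) :
    (inner ℝ (√(σ i ^ 2 - σ L ^ 2) • v i) x) ^ 2 =
      (σ i ^ 2 - σ L ^ 2) * (inner ℝ (v i) x) ^ 2 := by
  rw [real_inner_smul_left, mul_pow, Real.sq_sqrt (sub_nonneg.2 (h.val_sq_le hi.le))]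

/-- Shrinking the squared singular values by `σ L ^ 2` does not increase the quadratic form. -/
theorem shrink_le (h : IsRowSVD b a q σ v) (L : ℕ) (x : E) :
    ∑ i ∈ range L, (inner ℝ (√(σ i ^ 2 - σ L ^ 2) • v i) x) ^ 2 ≤
      ∑ i ∈ range a, (inner ℝ (b i) x) ^ 2 := by
  rw [h.quad_of_le (le_max_right L q)]
  refine le_trans (sum_le_sum fun i hi => ?_) (sum_le_sum_of_subset_of_nonneg
    (range_mono (le_max_left L q)) fun _ _ _ => by positivity)
  rw [h.shrink_inner_sq (by simpa using hi)]
  nlinarith [mul_nonneg (sq_nonneg (σ L)) (sq_nonneg (inner ℝ (v i) x))]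

/-- Shrinking the squared singular values by `σ L ^ 2` decreases the quadratic form by at most
`σ L ^ 2`. -/
theorem le_shrink (h : IsRowSVD b a q σ v) (L : ℕ) (x : E) :
    ∑ i ∈ range a, (inner ℝ (b i) x) ^ 2 ≤
      ∑ i ∈ range L, (inner ℝ (√(σ i ^ 2 - σ L ^ 2) • v i) x) ^ 2 + σ L ^ 2 * ‖x‖ ^ 2 := by
  rw [h.quad_of_le (le_max_right L q)]
  set N := max L q
  have h1 : ∑ i ∈ range L, (inner ℝ (√(σ i ^ 2 - σ L ^ 2) • v i) x) ^ 2 =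
      ∑ i ∈ range N, if i < L then (σ i ^ 2 - σ L ^ 2) * (inner ℝ (v i) x) ^ 2 else 0 := by
    rw [sum_range_ite_lt (le_max_left L q)]
    exact sum_congr rfl fun i hi => h.shrink_inner_sq (by simpa using hi) x
  have h2 := mul_le_mul_of_nonneg_left (h.bessel N x) (sq_nonneg (σ L))
  rw [h1]
  refine le_trans ?_ (add_le_add_right h2 _)
  rw [mul_sum, ← sum_add_distrib]
  -- Termwise: equality for `i < L`; for `L ≤ i` the whole term is lost, but `σ i ≤ σ L`.
  refine sum_le_sum fun i _ => ?_
  split_ifs with hi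
  · exact le_of_eq (by ring)
  · rw [zero_add]
    exact mul_le_mul_of_nonneg_right (h.val_sq_le (not_lt.1 hi)) (sq_nonneg _)

/-- Shrinking the squared singular values by `σ L ^ 2` decreases the Frobenius norm by at least
`L * σ L ^ 2`. -/
theorem shrink_norm_le [FiniteDimensional ℝ E] (h : IsRowSVD b a q σ v) (L : ℕ) :
    ∑ i ∈ range L, ‖√(σ i ^ 2 - σ L ^ 2) • v i‖ ^ 2 + L * σ L ^ 2 ≤
      ∑ i ∈ range a, ‖b i‖ ^ 2 := by
  rw [h.sum_norm_sq]
  refine le_trans ?_ (h.sum_val_sq_le L)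
  have : (L : ℝ) * σ L ^ 2 = ∑ i ∈ range L, σ L ^ 2 := by simp
  rw [this, ← sum_add_distrib]
  refine sum_le_sum fun i hi => ?_
  rw [norm_smul, mul_pow, Real.norm_eq_abs, sq_abs,
    Real.sq_sqrt (sub_nonneg.2 (h.val_sq_le (mem_range.1 hi).le))]
  -- Only `‖v i‖ ^ 2 ≤ 1` is available, because `v i = 0` when `q ≤ i`.
  nlinarith [h.norm_sq_le i, h.val_sq_le (mem_range.1 hi).le]

/-- The quadratic form summed over `k` orthonormal vectors is at most the sum of the largest `k`
squared singular values. -/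
theorem sum_quad_le (h : IsRowSVD b a q σ v) {k : ℕ} {w : Fin k → E} (hw : Orthonormal ℝ w) :
    ∑ j, ∑ i ∈ range a, (inner ℝ (b i) (w j)) ^ 2 ≤ ∑ i ∈ range k, σ i ^ 2 := by
  set N := max k q
  rw [sum_congr rfl fun j _ => h.quad_of_le (le_max_right k q) (w j), sum_comm]
  simp only [← mul_sum]
  -- `c i` is the squared length of the projection of `v i` to the span of `w`. The weights are at
  -- most `1` and add up to at most `k`, so the weighted sum is largest when they sit on the first
  -- `k` indices; comparing with the threshold `σ k ^ 2` proves this.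
  set c : ℕ → ℝ := fun i => ∑ j, (inner ℝ (v i) (w j)) ^ 2 with hc
  have hc0 : ∀ i, 0 ≤ c i := fun i => sum_nonneg fun _ _ => sq_nonneg _
  have hc1 : ∀ i, c i ≤ 1 := fun i => by
    have h1 := hw.sum_inner_products_le (s := univ) (v i)
    simp only [Real.norm_eq_abs, sq_abs] at h1
    refine le_trans (le_of_eq ?_) (h1.trans (h.norm_sq_le i))
    exact sum_congr rfl fun j _ => by rw [real_inner_comm]
  have hck : ∑ i ∈ range N, c i ≤ k := by
    rw [hc, sum_comm]
    refine (sum_le_sum fun j _ => h.bessel N (w j)).trans ?_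
    simp [hw.1]
  calc ∑ i ∈ range N, σ i ^ 2 * c i
      = ∑ i ∈ range N, (σ i ^ 2 - σ k ^ 2) * c i + σ k ^ 2 * ∑ i ∈ range N, c i := by
        rw [mul_sum, ← sum_add_distrib]
        exact sum_congr rfl fun i _ => by ring
    _ ≤ ∑ i ∈ range k, (σ i ^ 2 - σ k ^ 2) + σ k ^ 2 * k := by
        refine add_le_add ?_ (mul_le_mul_of_nonneg_left hck (sq_nonneg _))
        rw [← sum_range_ite_lt (le_max_left k q)]
        refine sum_le_sum fun i _ => ?_
        split_ifs with hi
        · exact mul_le_of_le_one_right (sub_nonneg.2 (h.val_sq_le hi.le)) (hc1 i)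
        · exact mul_nonpos_of_nonpos_of_nonneg (sub_nonpos.2 (h.val_sq_le (not_lt.1 hi))) (hc0 i)
    _ = ∑ i ∈ range k, σ i ^ 2 := by
        rw [sum_sub_distrib]
        simp [mul_comm]

/-- The largest singular value directions attain the bound of `sum_quad_le`, also when they are
completed to an orthonormal family because there are too few of them. -/
theorem le_sum_quad (h : IsRowSVD b a q σ v) {k m : ℕ} (hmk : m ≤ k) (hmq : m ≤ q)
    (hm : m = k ∨ q ≤ m) {x : ℕ → E} (hx : ∀ i < m, x i = v i) :
    ∑ i ∈ range k, σ i ^ 2 ≤ ∑ j ∈ range k, ∑ i ∈ range a, (inner ℝ (b i) (x j)) ^ 2 := by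
  have h1 : ∑ i ∈ range k, σ i ^ 2 = ∑ i ∈ range m, σ i ^ 2 := by
    refine (sum_subset (range_mono hmk) fun i hi hi' => ?_).symm
    rw [mem_range] at hi hi'
    rw [h.val_eq_zero i (by omega)]
    simp
  rw [h1]
  refine le_trans (sum_le_sum fun j hj => ?_) (sum_le_sum_of_subset_of_nonneg (range_mono hmk)
    fun j _ _ => sum_nonneg fun i _ => sq_nonneg _)
  rw [mem_range] at hj
  rw [hx j hj, h.quad]
  -- Only the term `i = j` of the quadratic form at `v j` is needed.
  refine le_trans (le_of_eq ?_) (single_le_sum (f := fun i => σ i ^ 2 * (inner ℝ (v i) (v j)) ^ 2)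
    (fun i _ => by positivity) (mem_range.2 (hj.trans_le hmq)))
  rw [h.orthonormal j (hj.trans_le hmq) j (hj.trans_le hmq), if_pos rfl, one_pow, mul_one]

end IsRowSVD

/-! ### Sketches and the error analysis of frequent directions -/

/-- A sketch `b` of the rows `A` of a matrix: its quadratic form is below that of `A` by at most
`Δ`, and its squared Frobenius norm is smaller by at least `L * Δ`. -/
structure IsSketch {E : Type*} [NormedAddCommGroup E] [InnerProductSpace ℝ E]
    (A : ℕ → E) (t : ℕ) (b : ℕ → E) (L : ℕ) (Δ : ℝ) : Prop where
  nonneg : 0 ≤ Δ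
  le : ∀ x, ∑ i ∈ Finset.range L, (inner ℝ (b i) x) ^ 2 ≤
    ∑ i ∈ Finset.range t, (inner ℝ (A i) x) ^ 2
  ge : ∀ x, ∑ i ∈ Finset.range t, (inner ℝ (A i) x) ^ 2 ≤
    ∑ i ∈ Finset.range L, (inner ℝ (b i) x) ^ 2 + Δ * ‖x‖ ^ 2
  norm : ∑ i ∈ Finset.range L, ‖b i‖ ^ 2 + L * Δ ≤ ∑ i ∈ Finset.range t, ‖A i‖ ^ 2

namespace IsSketch

open Finset

variable {E : Type*} [NormedAddCommGroup E] [InnerProductSpace ℝ E]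
  {A b : ℕ → E} {t L : ℕ} {Δ : ℝ}

theorem refl (A : ℕ → E) (L : ℕ) : IsSketch A L A L 0 where
  nonneg := le_rfl
  le _ := le_rfl
  ge _ := by simp
  norm := by simp

theorem congr (h : IsSketch A t b L Δ) {b' : ℕ → E} (hb : ∀ i < L, b' i = b i) :
    IsSketch A t b' L Δ := by
  have key : ∀ f : E → ℝ, ∑ i ∈ range L, f (b' i) = ∑ i ∈ range L, f (b i) := fun f =>
    sum_congr rfl fun i hi => by rw [hb i (mem_range.1 hi)]
  have h1 := fun x => key fun y => (inner ℝ y x) ^ 2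
  refine ⟨h.nonneg, fun x => ?_, fun x => ?_, ?_⟩
  · rw [h1]; exact h.le x
  · rw [h1]; exact h.ge x
  · rw [key fun y => ‖y‖ ^ 2]; exact h.norm

/-- The last batch of `L` rows may run past the points into rows that are zero; this removes them
from the count. -/
theorem of_eq_zero (h : IsSketch A t b L Δ) {n : ℕ} (hn : n ≤ t) (hA : ∀ i, n ≤ i → A i = 0) :
    IsSketch A n b L Δ := by
  have key : ∀ f : E → ℝ, f 0 = 0 → ∑ i ∈ range n, f (A i) = ∑ i ∈ range t, f (A i) :=
    fun f hf => sum_subset (range_mono hn) fun i _ hi => by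
      rw [hA i (by simpa using hi), hf]
  have h1 := fun x => key (fun y => (inner ℝ y x) ^ 2) (by simp)
  refine ⟨h.nonneg, fun x => ?_, fun x => ?_, ?_⟩
  · rw [h1]; exact h.le x
  · rw [h1]; exact h.ge x
  · rw [key (fun y => ‖y‖ ^ 2) (by simp)]; exact h.norm

/-- One step of the frequent directions algorithm. -/
theorem step [FiniteDimensional ℝ E] (h : IsSketch A t b L Δ) {b' : ℕ → E} {q : ℕ} {σ : ℕ → ℝ}
    {v : ℕ → E} (hb : ∀ i < L, b' i = b i) (hA : ∀ i < L, b' (L + i) = A (t + i))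
    (hs : IsRowSVD b' (L + L) q σ v) :
    IsSketch A (t + L) (fun i => √(σ i ^ 2 - σ L ^ 2) • v i) L (Δ + σ L ^ 2) := by
  have key : ∀ f : E → ℝ, ∑ i ∈ range (L + L), f (b' i) =
      ∑ i ∈ range L, f (b i) + ∑ i ∈ range L, f (A (t + i)) := fun f => by
    rw [sum_range_add]
    exact congrArg₂ _ (sum_congr rfl fun i hi => by rw [hb i (mem_range.1 hi)])
      (sum_congr rfl fun i hi => by rw [hA i (mem_range.1 hi)])
  have kt : ∀ f : E → ℝ, ∑ i ∈ range (t + L), f (A i) =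
      ∑ i ∈ range t, f (A i) + ∑ i ∈ range L, f (A (t + i)) := fun f => sum_range_add _ _ _
  refine ⟨add_nonneg h.nonneg (sq_nonneg _), fun x => ?_, fun x => ?_, ?_⟩
  · have h1 := hs.shrink_le L x
    have h2 := key fun y => (inner ℝ y x) ^ 2
    have h3 := kt fun y => (inner ℝ y x) ^ 2
    have h4 := h.le x
    linarith
  · have h1 := hs.le_shrink L x
    have h2 := key fun y => (inner ℝ y x) ^ 2
    have h3 := kt fun y => (inner ℝ y x) ^ 2
    have h4 := h.ge x
    linarith
  · have h1 := hs.shrink_norm_le L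
    have h2 := key fun y => ‖y‖ ^ 2
    have h3 := kt fun y => ‖y‖ ^ 2
    have h4 := h.norm
    linarith

end IsSketch

open Finset in
/-- The leading right singular vectors of a sketch span a nearly optimal flat. -/
theorem price_le_of_isSketch {n d k m L q : ℕ} {P : Fin n → EuclideanSpace ℝ (Fin d)}
    {A b v x : ℕ → EuclideanSpace ℝ (Fin d)} {Δ ε : ℝ} {σ : ℕ → ℝ} (hA : ∀ i : Fin n, A i = P i)
    (hs : IsSketch A n b L Δ) (hv : IsRowSVD b L q σ v) (hmk : m ≤ k) (hmq : m ≤ q)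
    (hm : m = k ∨ q ≤ m) (hx : ∀ i < m, x i = v i) (ho : Orthonormal ℝ fun i : Fin k => x i)
    (hε : 0 < ε) (hΔ : Δ = 0 ∨ 2 * (k : ℝ) ≤ (L - k) * ε)
    {W : Submodule ℝ (EuclideanSpace ℝ (Fin d))} (hW : IsFlat k W) :
    price P (Submodule.span ℝ (Set.range fun i : Fin k => x i)) ≤ (1 + ε / 2) * price P W := by
  obtain ⟨w, hw, rfl⟩ := hW.exists_orthonormal
  rw [price_span P ho, price_span P hw]
  have hS : ∑ i, ‖P i‖ ^ 2 = ∑ i ∈ range n, ‖A i‖ ^ 2 := by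
    rw [← Fin.sum_univ_eq_sum_range (fun i => ‖A i‖ ^ 2)]
    simp only [hA]
  have hq : ∀ y, ∑ i, (inner ℝ (P i) y) ^ 2 = ∑ i ∈ range n, (inner ℝ (A i) y) ^ 2 := fun y => by
    rw [← Fin.sum_univ_eq_sum_range (fun i => (inner ℝ (A i) y) ^ 2)]
    simp only [hA]
  simp only [hS, hq]
  have h1 : ∑ j, ∑ i ∈ range L, (inner ℝ (b i) (w j)) ^ 2 ≤
      ∑ j : Fin k, ∑ i ∈ range L, (inner ℝ (b i) (x j)) ^ 2 := by
    rw [Fin.sum_univ_eq_sum_range (fun j => ∑ i ∈ range L, (inner ℝ (b i) (x j)) ^ 2)]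
    exact (hv.sum_quad_le hw).trans (hv.le_sum_quad hmk hmq hm hx)
  have h2 : ∑ j : Fin k, ∑ i ∈ range L, (inner ℝ (b i) (x j)) ^ 2 ≤
      ∑ j : Fin k, ∑ i ∈ range n, (inner ℝ (A i) (x j)) ^ 2 := sum_le_sum fun j _ => hs.le _
  have h3 : ∑ j, ∑ i ∈ range n, (inner ℝ (A i) (w j)) ^ 2 ≤
      ∑ j, ∑ i ∈ range L, (inner ℝ (b i) (w j)) ^ 2 + k * Δ := by
    refine (sum_le_sum fun j _ => hs.ge _).trans (le_of_eq ?_)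
    rw [sum_add_distrib]
    simp [hw.1]
  have h4 : ∑ j, ∑ i ∈ range L, (inner ℝ (b i) (w j)) ^ 2 ≤ ∑ i ∈ range L, ‖b i‖ ^ 2 := by
    rw [sum_comm]
    refine sum_le_sum fun i _ => ?_
    have h1 := hw.sum_inner_products_le (s := univ) (b i)
    simp only [Real.norm_eq_abs, sq_abs] at h1
    refine le_trans (le_of_eq ?_) h1
    exact sum_congr rfl fun j _ => by rw [real_inner_comm]
  have h5 := hs.norm
  set S := ∑ i ∈ range n, ‖A i‖ ^ 2
  set Q := ∑ j, ∑ i ∈ range n, (inner ℝ (A i) (w j)) ^ 2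
  -- `Q ≤ ∑ ‖b i‖ ^ 2 + k Δ ≤ S - L Δ + k Δ`, by `h3`, `h4` and `h5`.
  have h6 : (L - k) * Δ ≤ S - Q := by nlinarith
  have h7 : k * Δ ≤ ε / 2 * (S - Q) := by
    have hΔ0 := hs.nonneg
    have hSQ : 0 ≤ S - Q := by
      rw [sub_nonneg]
      have : Q = ∑ i ∈ range n, ∑ j, (inner ℝ (A i) (w j)) ^ 2 := sum_comm
      rw [this]
      refine sum_le_sum fun i _ => ?_
      have h1 := hw.sum_inner_products_le (s := univ) (A i)
      simp only [Real.norm_eq_abs, sq_abs] at h1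
      refine le_trans (le_of_eq ?_) h1
      exact sum_congr rfl fun j _ => by rw [real_inner_comm]
    rcases hΔ with rfl | hΔ
    · rw [mul_zero]; positivity
    · nlinarith [mul_le_mul_of_nonneg_right hΔ hΔ0, mul_le_mul_of_nonneg_left h6 hε.le]
  linarith

/-! ### Householder reflections -/

/-- The reflection along the vector `w`. -/
noncomputable def reflect {E : Type*} [NormedAddCommGroup E] [InnerProductSpace ℝ E] (w x : E) : E :=
  x - (2 * inner ℝ w x / inner ℝ w w) • w

/-- Reflecting an orthonormal family keeps it orthonormal. -/
theorem inner_reflect {E : Type*} [NormedAddCommGroup E] [InnerProductSpace ℝ E] (w x y : E) :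
    inner ℝ (reflect w x) (reflect w y) = inner ℝ x y := by
  unfold reflect
  rcases eq_or_ne w 0 with rfl | hw
  · simp
  have h : inner ℝ w w ≠ 0 := inner_self_ne_zero.2 hw
  simp only [inner_sub_left, inner_sub_right, real_inner_smul_left, real_inner_smul_right]
  rw [real_inner_comm w x]
  field_simp
  ring

/-- The reflection that exchanges two unit vectors. -/
theorem reflect_sub {E : Type*} [NormedAddCommGroup E] [InnerProductSpace ℝ E] {x v : E}
    (hx : inner ℝ x x = (1 : ℝ)) (hv : inner ℝ v v = (1 : ℝ)) :
    reflect (x - v) x = v := by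
  unfold reflect
  rcases eq_or_ne (x - v) 0 with h | h
  · rw [h]
    -- The coefficient is `0 / 0` here, but it multiplies the zero vector, so the machine needs no
    -- test for `x = v`.
    simp [sub_eq_zero.1 h]
  have h' : inner ℝ (x - v) (x - v) ≠ (0 : ℝ) := inner_self_ne_zero.2 h
  have : 2 * inner ℝ (x - v) x = inner ℝ (x - v) (x - v) := by
    simp only [inner_sub_left, inner_sub_right, hx, hv]
    rw [real_inner_comm v x]
    ring
  rw [this, div_self h', one_smul, sub_sub_cancel]

/-! ### The decomposition computed by the machine -/

/-- The vector formed by the first `d` entries of row `i` of the array number `A`. -/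
noncomputable def rowVec (d : ℕ) (arr : ℕ → ℕ → ℕ → ℝ) (A i : ℕ) : EuclideanSpace ℝ (Fin d) :=
  WithLp.toLp 2 fun j => arr A i j

theorem inner_rowVec {d : ℕ} (arr arr' : ℕ → ℕ → ℕ → ℝ) (A A' i i' : ℕ) :
    inner ℝ (rowVec d arr A i) (rowVec d arr' A' i') =
      ∑ j ∈ Finset.range d, arr A i j * arr' A' i' j := by
  rw [← Fin.sum_univ_eq_sum_range (fun j => arr A i j * arr' A' i' j)]
  simp only [rowVec, PiLp.inner_apply, RCLike.inner_apply, conj_trivial]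
  exact Finset.sum_congr rfl fun _ _ => mul_comm _ _

/-- The columns of `U` are orthonormal, so `U` preserves lengths and drops out. Only `σ` and `V`
matter from here on. -/
theorem IsThinSVD.sum_mulVec_sq {a b q : ℕ} {M : Matrix (Fin a) (Fin b) ℝ}
    {U : Matrix (Fin a) (Fin q) ℝ} {σ : Fin q → ℝ} {V : Matrix (Fin b) (Fin q) ℝ}
    (h : IsThinSVD M U σ V) (x : Fin b → ℝ) :
    ∑ i, (M *ᵥ x) i ^ 2 = ∑ i, σ i ^ 2 * (Vᵀ *ᵥ x) i ^ 2 := by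
  set y := Vᵀ *ᵥ x with hy
  have h1 : M *ᵥ x = U *ᵥ (Matrix.diagonal σ *ᵥ y) := by
    rw [h.eq_mul, hy, Matrix.mulVec_mulVec, Matrix.mulVec_mulVec, Matrix.mul_assoc]
  have h2 : (M *ᵥ x) ⬝ᵥ (M *ᵥ x) = (Matrix.diagonal σ *ᵥ y) ⬝ᵥ (Matrix.diagonal σ *ᵥ y) := by
    rw [h1, Matrix.dotProduct_mulVec, Matrix.vecMul_mulVec, h.left_orthonormal, Matrix.vecMul_one]
  simp only [dotProduct, Matrix.mulVec_diagonal] at h2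
  simp only [sq]
  rw [h2]
  exact Finset.sum_congr rfl fun i _ => by ring

/-- The state after a singular value decomposition. -/
theorem Config.svd_spec (s : Config) (A a d U S V : ℕ) (hUS : U ≠ S) (hSV : S ≠ V) :
    ∃ (σ : ℕ → ℝ) (v : ℕ → EuclideanSpace ℝ (Fin d)),
      IsRowSVD (rowVec d s.arr A) a (min a d) σ v ∧
      (∀ i < min a d, (s.svd A a d U S V).arr S 0 i = σ i) ∧
      (∀ i, min a d ≤ i → (s.svd A a d U S V).arr S 0 i = s.arr S 0 i) ∧
      (∀ i < min a d, ∀ j : Fin d, (s.svd A a d U S V).arr V j i = v i j) ∧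
      (∀ B, B ≠ U → B ≠ S → B ≠ V → (s.svd A a d U S V).arr B = s.arr B) := by
  set M := getMatrix s.arr A a d with hM
  have h := thinSVD_spec M
  set q := min a d with hq
  set σ : ℕ → ℝ := fun i => if h : i < q then (thinSVD M).2.1 ⟨i, h⟩ else 0 with hσ
  set v : ℕ → EuclideanSpace ℝ (Fin d) := fun i =>
    if h : i < q then WithLp.toLp 2 fun j => (thinSVD M).2.2 j ⟨i, h⟩ else 0 with hv
  have hσ1 : ∀ i : Fin q, σ i = (thinSVD M).2.1 i := fun i => by simp [hσ]
  have hv1 : ∀ i : Fin q, v i = WithLp.toLp 2 fun j => (thinSVD M).2.2 j i := fun i => by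
    simp [hv]
  have hσ0 : ∀ i, q ≤ i → σ i = 0 := fun i hi => by simp [hσ, not_lt.2 hi]
  have hnn : ∀ i, 0 ≤ σ i := fun i => by
    by_cases hi : i < q
    · rw [hσ1 ⟨i, hi⟩]; exact h.nonneg _
    · rw [hσ0 i (not_lt.1 hi)]
  refine ⟨σ, v, ⟨?_, fun i hi => ?_, hnn, fun i j hij => ?_, hσ0, fun x => ?_⟩, ?_, ?_, ?_, ?_⟩
  · intro i hi j hj
    have h1 := congrFun (congrFun h.right_orthonormal ⟨i, hi⟩) ⟨j, hj⟩
    rw [Matrix.mul_apply, Matrix.one_apply] at h1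
    simp only [Fin.mk.injEq] at h1
    rw [← h1, hv1 ⟨i, hi⟩, hv1 ⟨j, hj⟩]
    simp only [PiLp.inner_apply, RCLike.inner_apply, conj_trivial, Matrix.transpose_apply]
    exact Finset.sum_congr rfl fun _ _ => mul_comm _ _
  · simp [hv, not_lt.2 hi]
  · by_cases hj : j < q
    · rw [hσ1 ⟨i, hij.trans_lt hj⟩, hσ1 ⟨j, hj⟩]
      exact h.antitone hij
    · rw [hσ0 j (not_lt.1 hj)]
      exact hnn i
  · have h1 := h.sum_mulVec_sq (WithLp.ofLp x)
    rw [← Fin.sum_univ_eq_sum_range (fun i => (inner ℝ (rowVec d s.arr A i) x) ^ 2),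
      ← Fin.sum_univ_eq_sum_range (fun i => σ i ^ 2 * (inner ℝ (v i) x) ^ 2)]
    refine Eq.trans (Finset.sum_congr rfl fun i _ => ?_)
      (h1.trans (Finset.sum_congr rfl fun i _ => ?_))
    · simp only [rowVec, PiLp.inner_apply, RCLike.inner_apply, conj_trivial, hM, getMatrix,
        Matrix.mulVec, dotProduct, Matrix.of_apply]
      exact congrArg (· ^ 2) (Finset.sum_congr rfl fun _ _ => mul_comm _ _)
    · rw [hσ1, hv1]
      simp only [PiLp.inner_apply, RCLike.inner_apply, conj_trivial, Matrix.mulVec, dotProduct,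
        Matrix.transpose_apply]
      exact congrArg (_ * · ^ 2) (Finset.sum_congr rfl fun _ _ => mul_comm _ _)
  · intro i hi
    rw [hσ1 ⟨i, hi⟩]
    simp [Config.svd, putMatrix, hSV, ← hM, ← hq, hi]
  · intro i hi
    simp [Config.svd, putMatrix, hSV, hUS.symm, ← hq, not_lt.2 hi]
  · intro i hi j
    rw [hv1 ⟨i, hi⟩]
    simp [Config.svd, putMatrix, ← hM, ← hq, hi]
  · intro B h1 h2 h3
    funext i j
    simp [Config.svd, putMatrix, h1, h2, h3]

/-! ### Program logic -/

/-- Started in `s`, the program `p` halts after at most `T` steps in a configuration with the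
property `Q`. -/
def Triple (ω : Tape) (p : Prog) (s : Config) (T : ℕ) (Q : Config → Prop) : Prop :=
  ∃ T' ≤ T, ∃ s', Exec ω p s T' s' ∧ Q s'

namespace Triple

variable {ω : Tape} {p p₁ p₂ : Prog} {s : Config} {T T₁ T₂ : ℕ} {Q R : Config → Prop}

theorem mono (h : Triple ω p s T₁ Q) (hT : T₁ ≤ T₂) (hQ : ∀ s, Q s → R s) : Triple ω p s T₂ R := by
  obtain ⟨T', h1, s', h2, h3⟩ := h
  exact ⟨T', h1.trans hT, s', h2, hQ _ h3⟩

theorem seq (h₁ : Triple ω p₁ s T₁ R) (h₂ : ∀ s, R s → Triple ω p₂ s T₂ Q) :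
    Triple ω (.seq p₁ p₂) s (T₁ + T₂) Q := by
  obtain ⟨T', h1, s', h2, h3⟩ := h₁
  obtain ⟨T'', h1', s'', h2', h3'⟩ := h₂ s' h3
  exact ⟨T' + T'', add_le_add h1 h1', s'', .seq h2 h2', h3'⟩

theorem skip (h : Q s) : Triple ω .skip s 1 Q := ⟨1, le_rfl, s, .skip s, h⟩

theorem setReg {x : ℕ} {e : NExpr} (h : Q (s.setReg x (e.eval s))) :
    Triple ω (.setReg x e) s (e.cost + 1) Q := ⟨_, le_rfl, _, .setReg s x e, h⟩

theorem setEntry {A : ℕ} {i j : NExpr} {e : RExpr}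
    (h : Q (s.setEntry A (i.eval s) (j.eval s) (e.eval s))) :
    Triple ω (.setEntry A i j e) s (i.cost + j.cost + e.cost + 1) Q :=
  ⟨_, le_rfl, _, .setEntry s A i j e, h⟩

theorem svd {A U S V : ℕ} {a b : NExpr} (h : Q (s.svd A (a.eval s) (b.eval s) U S V)) :
    Triple ω (.svd A a b U S V) s
      (a.cost + b.cost + a.eval s * b.eval s * min (a.eval s) (b.eval s) + 1) Q :=
  ⟨_, le_rfl, _, .svd s A a b U S V, h⟩

theorem ite {t : Test} (h₁ : t.Holds s → Triple ω p₁ s T Q) (h₂ : ¬ t.Holds s → Triple ω p₂ s T Q) :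
    Triple ω (.ite t p₁ p₂) s (t.cost + T) Q := by
  by_cases ht : t.Holds s
  · obtain ⟨T', h1, s', h2, h3⟩ := h₁ ht
    exact ⟨_, Nat.add_le_add_left h1 _, s', .ite_true ht h2, h3⟩
  · obtain ⟨T', h1, s', h2, h3⟩ := h₂ ht
    exact ⟨_, Nat.add_le_add_left h1 _, s', .ite_false ht h2, h3⟩

/-- The rule for a loop with invariant `I`, the body of which runs at most `J` times. -/
theorem whileLoop {t : Test} {J c : ℕ} (I : ℕ → Config → Prop) (h₀ : I 0 s)
    (hb : ∀ j s, I j s → t.Holds s → j < J ∧ Triple ω p s c (I (j + 1))) :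
    Triple ω (.while t p) s (J * (t.cost + c) + t.cost)
      fun s' => ¬ t.Holds s' ∧ ∃ j, I j s' := by
  -- Induction on a bound `m` for the number of iterations that remain after the `j`-th.
  suffices H : ∀ m j s, J ≤ j + m → I j s → Triple ω (.while t p) s (m * (t.cost + c) + t.cost)
      fun s' => ¬ t.Holds s' ∧ ∃ j, I j s' from H J 0 s (by omega) h₀
  intro m
  induction m with
  | zero =>
    intro j s hj hI
    have ht : ¬ t.Holds s := fun ht => by have := (hb j s hI ht).1; omega
    exact ⟨t.cost, by omega, s, .while_false ht, ht, j, hI⟩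
  | succ m ih =>
    intro j s hj hI
    by_cases ht : t.Holds s
    · obtain ⟨T', h1, s', h2, h3⟩ := (hb j s hI ht).2
      obtain ⟨T'', h1', s'', h2', h3'⟩ := ih (j + 1) s' (by omega) h3
      refine ⟨_, ?_, s'', .while_true ht h2 h2', h3'⟩
      rw [Nat.succ_mul]
      omega
    · exact ⟨t.cost, by omega, s, .while_false ht, ht, j, hI⟩

end Triple

/-! ### Counting loops and the loops that fill rows and blocks -/

/-- Run `p` with the register `r` equal to `0, 1, …, e - 1`. -/
def forLoop (r : ℕ) (e : NExpr) (p : Prog) : Prog :=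
  .seq (.setReg r (.const 0)) (.while (.nlt (.reg r) e) (.seq p (.setReg r (.add (.reg r) (.const 1)))))

/-- For `j = 0, …, e - 1`, kept in the register `r`, store the value of `v` in the entry `(i, j)` of
the array `A`. -/
def fillRow (r : ℕ) (e : NExpr) (A : ℕ) (i : NExpr) (v : RExpr) : Prog :=
  forLoop r e (.setEntry A i (.reg r) v)

/-- Store the sum of the values of `v` for `j = 0, …, e - 1`, kept in the register `r`, in the entry
`(0, c)` of the array `A`. -/
def sumRow (r : ℕ) (e : NExpr) (A c : ℕ) (v : RExpr) : Prog :=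
  .seq (.setEntry A (.const 0) (.const c) (.ofIndex (.const 0)))
    (forLoop r e (.setEntry A (.const 0) (.const c) (.add (.entry A (.const 0) (.const c)) v)))

/-- Fill `a` rows of the array `A`, the row numbers being the values of `i`, with `b` values of `v`
each. The indices run through the registers `6` and `7`. -/
def fillBlock (a b : NExpr) (A : ℕ) (i : NExpr) (v : RExpr) : Prog :=
  forLoop 6 a (fillRow 7 b A i v)

/-- The array with the first `m` entries of row `i` replaced. -/
def setRow (arr : ℕ → ℕ → ℕ → ℝ) (A i m : ℕ) (f : ℕ → ℝ) : ℕ → ℕ → ℕ → ℝ :=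
  fun B i' j => if B = A ∧ i' = i ∧ j < m then f j else arr B i' j

/-- The array with the first `b` entries of each of the rows `i, …, i + a - 1` replaced. -/
def setBlock (arr : ℕ → ℕ → ℕ → ℝ) (A i a b : ℕ) (f : ℕ → ℕ → ℝ) : ℕ → ℕ → ℕ → ℝ :=
  fun B i' j => if B = A ∧ i ≤ i' ∧ i' < i + a ∧ j < b then f (i' - i) j else arr B i' j

namespace Triple

variable {ω : Tape} {p : Prog} {s : Config} {Q : Config → Prop}

/-- Since `1 ≤ m`, the initialization and the last test are charged to the iterations, and time
bounds remain pure products. The body has to leave the counter as it found it. -/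
theorem forLoop {r : ℕ} {e : NExpr} {m c : ℕ} (hm : 1 ≤ m) (I : ℕ → Config → Prop) (h₀ : I 0 (s.setReg r 0))
    (he : ∀ i s, I i s → e.eval s = m)
    (hb : ∀ i s, i < m → I i s → s.reg r = i →
      Triple ω p s c fun s' => s'.reg r = i ∧ I (i + 1) (s'.setReg r (i + 1))) :
    Triple ω (forLoop r e p) s (m * (c + 2 * e.cost + 10)) (I m) := by
  refine mono (T₁ := 2 + (m * ((e.cost + 2) + (c + 4)) + (e.cost + 2))) (seq
    (R := fun s => I 0 s ∧ s.reg r = 0 ∧ 0 ≤ m) (setReg (e := .const 0) ?_) fun s hs =>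
    (whileLoop (t := .nlt (.reg r) e) (J := m) (c := c + 4) (fun i s => I i s ∧ s.reg r = i ∧ i ≤ m)
      hs fun i s hI ht => ?_).mono ?_ ?_) ?_ (fun _ h => h)
  · exact ⟨h₀, by simp [Config.setReg, NExpr.eval], Nat.zero_le _⟩
  · have h1 : i < m := by
      have : s.reg r < e.eval s := ht
      rwa [he i s hI.1, hI.2.1] at this
    refine ⟨h1, seq (hb i s h1 hI.1 hI.2.1) fun s' hs' => ?_⟩
    refine setReg (e := .add (.reg r) (.const 1)) ?_
    simp only [NExpr.eval, hs'.1]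
    exact ⟨hs'.2, by simp [Config.setReg], h1⟩
  · simp only [Test.cost, NExpr.cost]
    exact le_of_eq (by ring)
  · rintro s ⟨ht, i, hI, hi, him⟩
    have : ¬ s.reg r < e.eval s := ht
    rw [he i s hI, hi] at this
    obtain rfl : i = m := by omega
    exact hI
  · nlinarith [Nat.mul_le_mul_right (e.cost + 4) hm]

/-- The expressions are evaluated when the first `j` entries have already been replaced, so `v` may
read entry `j` of the row being overwritten. In-place reflection relies on this. -/
theorem fillRow {r : ℕ} {e : NExpr} {A : ℕ} {i : NExpr} {v : RExpr} {m a : ℕ} {f : ℕ → ℝ}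
    (hm : 1 ≤ m)
    (he : ∀ j, e.eval ⟨Function.update s.reg r j, setRow s.arr A a j f, s.drawn⟩ = m)
    (hi : ∀ j, i.eval ⟨Function.update s.reg r j, setRow s.arr A a j f, s.drawn⟩ = a)
    (hv : ∀ j < m, v.eval ⟨Function.update s.reg r j, setRow s.arr A a j f, s.drawn⟩ = f j) :
    Triple ω (fillRow r e A i v) s (m * (i.cost + v.cost + 2 * e.cost + 12))
      (· = ⟨Function.update s.reg r m, setRow s.arr A a m f, s.drawn⟩) := by
  refine (forLoop (m := m) hm (c := i.cost + v.cost + 2)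
    (fun j s' => s' = ⟨Function.update s.reg r j, setRow s.arr A a j f, s.drawn⟩) ?_ ?_ ?_).mono
    ?_ fun _ h => h
  · have : s.arr = setRow s.arr A a 0 f := by
      funext B i' j'
      simp [setRow]
    rw [← this]
    rfl
  · rintro j _ rfl
    exact he j
  · rintro j _ hj rfl -
    refine (setEntry ⟨?_, ?_⟩).mono ?_ fun _ h => h
    · simp only [NExpr.cost]
      exact le_of_eq (by ring)
    · simp [Config.setEntry]
    · simp only [Config.setReg, Config.setEntry, hi, hv j hj, NExpr.eval, Function.update_self,
        Function.update_idem]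
      congr 1
      funext B i' j'
      simp only [setRow]
      by_cases h1 : B = A ∧ i' = a
      · rcases lt_trichotomy j' j with h | h | h
        · simp [h1, h.ne, h, Nat.lt_succ_of_lt h]
        · simp [h1, h]
        · have h3 : ¬ j' < j + 1 := by omega
          simp [h.ne', h.not_gt, h3]
      · have h2 : ∀ q : Prop, ¬ (B = A ∧ i' = a ∧ q) := fun q hq => h1 ⟨hq.1, hq.2.1⟩
        simp [h2]
  · exact le_of_eq (by ring)

/-- The hypotheses quantify over the content `x` of the accumulator: neither the bound nor the
summands may depend on it. -/
theorem sumRow {r : ℕ} {e : NExpr} {A c : ℕ} {v : RExpr} {m : ℕ} {f : ℕ → ℝ}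
    (hm : 1 ≤ m)
    (he : ∀ j x, e.eval { s.setEntry A 0 c x with reg := Function.update s.reg r j } = m)
    (hv : ∀ j x, j < m →
      v.eval { s.setEntry A 0 c x with reg := Function.update s.reg r j } = f j) :
    Triple ω (sumRow r e A c v) s (m * (v.cost + 2 * e.cost + 23))
      (· = { s.setEntry A 0 c (∑ j ∈ Finset.range m, f j) with
        reg := Function.update s.reg r m }) := by
  refine (seq (setEntry (Q := (· = s.setEntry A 0 c 0)) ?_) fun s' hs' => forLoop (m := m) hm
    (c := v.cost + 7) (fun j s' => s' = { s.setEntry A 0 c (∑ j ∈ Finset.range j, f j) with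
        reg := Function.update s.reg r j }) ?_ ?_ ?_).mono ?_ fun _ h => h
  · simp [NExpr.eval, RExpr.eval]
  · subst hs'
    simp [Config.setReg, Config.setEntry]
  · rintro j _ rfl
    exact he j _
  · rintro j _ hj rfl -
    refine (setEntry ⟨?_, ?_⟩).mono ?_ fun _ h => h
    · simp only [NExpr.cost, RExpr.cost]
      exact le_of_eq (by ring)
    · simp [Config.setEntry]
    · simp only [RExpr.eval, hv j _ hj, NExpr.eval]
      simp only [Config.setReg, Config.setEntry, Function.update_idem, Finset.sum_range_succ]
      congr 1
      funext B i' j'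
      by_cases h : B = A ∧ i' = 0 ∧ j' = c <;> simp [h]
  · simp only [NExpr.cost, RExpr.cost]
    nlinarith

/-- The expressions must have the same values whatever the array `A` holds, so no invariant about
the partly filled block is needed to evaluate them. -/
theorem fillBlock {ea eb : NExpr} {A : ℕ} {ei : NExpr} {v : RExpr} {a b i₀ : ℕ} {f : ℕ → ℕ → ℝ}
    (ha : 1 ≤ a) (hb : 1 ≤ b)
    (h : ∀ s' i, (∀ r, r ≠ 6 → r ≠ 7 → s'.reg r = s.reg r) → (∀ B ≠ A, s'.arr B = s.arr B) →
      s'.reg 6 = i → ea.eval s' = a ∧ eb.eval s' = b ∧ ei.eval s' = i₀ + i ∧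
        ∀ j, s'.reg 7 = j → i < a → j < b → v.eval s' = f i j) :
    Triple ω (fillBlock ea eb A ei v) s
      (a * b * (ei.cost + v.cost + 2 * eb.cost + 2 * ea.cost + 22))
      fun s' => (∀ r, r ≠ 6 → r ≠ 7 → s'.reg r = s.reg r) ∧
        s'.arr = setBlock s.arr A i₀ a b f ∧ s'.drawn = s.drawn := by
  have hB : ∀ i (B : ℕ), B ≠ A → setBlock s.arr A i₀ i b f B = s.arr B := fun i B hBA => by
    funext i' j
    simp [setBlock, hBA]
  refine (forLoop (m := a) ha (c := b * (ei.cost + v.cost + 2 * eb.cost + 12))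
    (fun i s' => (∀ r, r ≠ 6 → r ≠ 7 → s'.reg r = s.reg r) ∧
        s'.arr = setBlock s.arr A i₀ i b f ∧ s'.drawn = s.drawn) ?_ ?_ ?_).mono ?_ fun _ h => h
  · refine ⟨fun r h6 _ => by simp [Config.setReg, h6], ?_, rfl⟩
    funext B i' j
    have : ¬ (B = A ∧ i₀ ≤ i' ∧ i' < i₀ ∧ j < b) := by omega
    simp [Config.setReg, setBlock, this]
  · rintro i s' ⟨h1, h2, -⟩
    exact (h s' _ h1 (fun B hBA => by rw [h2, hB i B hBA]) rfl).1
  · rintro i s' hia ⟨h1, h2, h3⟩ h6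
    have key : ∀ j, _ := fun j => h ⟨Function.update s'.reg 7 j,
      setRow s'.arr A (i₀ + i) j (f i), s'.drawn⟩ i
      (fun r h6 h7 => by rw [← h1 r h6 h7]; simp [h7])
      (fun B hBA => by
        rw [← hB i B hBA, ← h2]
        funext i' j
        simp [setRow, hBA]) (by simpa using h6)
    refine (fillRow (m := b) hb (a := i₀ + i) (f := f i) (fun j => (key j).2.1)
      (fun j => (key j).2.2.1) fun j hj => (key j).2.2.2 j (by simp) hia hj).mono le_rfl ?_
    rintro _ rfl
    refine ⟨by simpa using h6, fun r h6 h7 => ?_, ?_, h3⟩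
    · rw [← h1 r h6 h7]
      simp [Config.setReg, h6, h7]
    · funext B i' j
      simp only [Config.setReg, setRow, h2, setBlock]
      by_cases hBj : B = A ∧ j < b
      · rcases lt_trichotomy i' (i₀ + i) with h | h | h
        · have : i' < i₀ + (i + 1) := by omega
          simp [h, h.ne, this]
        · subst h
          simp [hBj]
        · have h5 : ¬ i' < i₀ + (i + 1) := by omega
          simp [h.ne', h.not_gt, h5]
      · have h5 : ∀ q q' : Prop, ¬ (B = A ∧ q ∧ q' ∧ j < b) := by tauto
        have h6 : ∀ q : Prop, ¬ (B = A ∧ q ∧ j < b) := by tauto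
        simp [h5, h6]
  · have h1 := Nat.mul_le_mul_right (2 * ea.cost + 10) hb
    have h2 := Nat.mul_le_mul_left a h1
    nlinarith

end Triple

/-! ### The algorithm

The algorithm is the deterministic method of frequent directions, which needs neither random
numbers nor an approximate flat, and achieves the bound without the additive term. It keeps a sketch of `L` rows,
`L = min n (k + ⌈2 k / ε⌉)`. The next `L` points are appended to the sketch, and the resulting
`2 L` rows are replaced by the `L` leading right singular vectors, scaled by the singular values
after their squares have been diminished by the square of singular value number `L`. The leading
right singular vectors of the final sketch are completed to `k` orthonormal vectors by Householder
reflections.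

The registers `4` and `5` hold `L` and the number of points seen so far. The sketch is kept in the
array `4`, and the array `3` receives the result. -/

namespace FrequentDirections

/-- A real cannot be turned into an index, so `⌈2 k / ε⌉` is found by counting: `L` grows while `(L
- k) ε < 2 k`. Truncated subtraction makes the left side `0` as long as `L ≤ k`, and then the test
succeeds because `k` is positive. Running this `n` times also enforces `L ≤ n`. -/
def sizeStep : Prog :=
  .ite (.rlt (.mul (.ofIndex (.sub (.reg 4) (.reg 2))) (.entry 2 (.const 0) (.const 0)))
    (.ofIndex (.mul (.const 2) (.reg 2)))) (.setReg 4 (.add (.reg 4) (.const 1))) .skip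

/-- Compute the number `L` of rows of the sketch. -/
def sketchSize : Prog := forLoop 6 (.reg 0) sizeStep

/-- Copy the first `L` points to the sketch. -/
def copyHead : Prog :=
  fillBlock (.reg 4) (.reg 1) 4 (.reg 6) (.entry 0 (.reg 6) (.reg 7))

/-- Append the next `L` points to the sketch. -/
def copyNext : Prog :=
  fillBlock (.reg 4) (.reg 1) 4 (.add (.reg 4) (.reg 6))
    (.entry 0 (.add (.reg 5) (.reg 6)) (.reg 7))

/-- The square of a singular value. -/
def valSq (e : NExpr) : RExpr := .mul (.entry 6 (.const 0) e) (.entry 6 (.const 0) e)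

/-- Replace the sketch by the shrunk singular vectors. -/
def shrink : Prog :=
  fillBlock (.reg 4) (.reg 1) 4 (.reg 6)
    (.mul (.sqrt (.sub (valSq (.reg 6)) (valSq (.reg 4)))) (.entry 7 (.reg 7) (.reg 6)))

def sketchStep : Prog :=
  .seq copyNext (.seq (.svd 4 (.add (.reg 4) (.reg 4)) (.reg 1) 5 6 7)
    (.seq shrink (.setReg 5 (.add (.reg 5) (.reg 4)))))

/-- Compute the sketch. -/
def sketch : Prog :=
  .seq copyHead (.seq (.setReg 5 (.reg 4)) (.while (.nlt (.reg 5) (.reg 0)) sketchStep))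

/-- Store the first `k` unit vectors in the array `3`. -/
def unitVectors : Prog :=
  fillBlock (.reg 2) (.reg 1) 3 (.reg 6)
    (.ofIndex (.sub (.const 1) (.add (.sub (.reg 6) (.reg 7)) (.sub (.reg 7) (.reg 6)))))

/-- Reflect one row of the array `3` along the vector stored in the array `11`. -/
def reflectRow : Prog :=
  .seq (sumRow 7 (.reg 1) 12 1 (.mul (.entry 11 (.const 0) (.reg 7)) (.entry 3 (.reg 8) (.reg 7))))
    (fillRow 7 (.reg 1) 3 (.reg 8) (.sub (.entry 3 (.reg 8) (.reg 7))
      (.mul (.div (.mul (.ofIndex (.const 2)) (.entry 12 (.const 0) (.const 1)))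
        (.entry 12 (.const 0) (.const 0))) (.entry 11 (.const 0) (.reg 7)))))

/-- Reflect all rows of the array `3` such that one row becomes a given singular vector. -/
def reflectStep : Prog :=
  .seq (fillRow 7 (.reg 1) 11 (.const 0)
      (.sub (.entry 3 (.reg 6) (.reg 7)) (.entry 10 (.reg 7) (.reg 6))))
    (.seq (sumRow 7 (.reg 1) 12 0
        (.mul (.entry 11 (.const 0) (.reg 7)) (.entry 11 (.const 0) (.reg 7))))
      (forLoop 8 (.reg 2) reflectRow))

/-- Complete the first `min n k` columns of the array `10` to `k` orthonormal vectors. -/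
def complete : Prog :=
  .seq unitVectors (forLoop 6 (.sub (.reg 0) (.sub (.reg 0) (.reg 2))) reflectStep)

def program : Prog :=
  .seq sketchSize (.seq sketch (.seq (.svd 4 (.reg 4) (.reg 1) 8 9 10) complete))

/-! ### Correctness of the parts -/

variable {ω : Tape} {s : Config} {n d k L m : ℕ}

/-- The lower bound on `L` (or `L = n`, where the sketch is exact) serves the accuracy, the upper
bound the running time. The latter is the test that allowed the last increment. -/
theorem sketchSize_spec {ε : ℝ} (hn : 1 ≤ n) (hk : 1 ≤ k) (h0 : s.reg 0 = n) (h2 : s.reg 2 = k)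
    (h4 : s.reg 4 = 0) (hε : s.arr 2 0 0 = ε) :
    Triple ω sketchSize s (n * 40) fun s' => s'.arr = s.arr ∧
      (∀ r, r ≠ 4 → r ≠ 6 → s'.reg r = s.reg r) ∧ 1 ≤ s'.reg 4 ∧ s'.reg 4 ≤ n ∧
      (s'.reg 4 = n ∨ k ≤ s'.reg 4 ∧ 2 * (k : ℝ) ≤ (s'.reg 4 - k) * ε) ∧
      (s'.reg 4 ≤ k + 1 ∨ (s'.reg 4 - 1 - k) * ε ≤ 2 * k) := by
  -- Invariant: either every test so far has succeeded, and `L` is the loop counter, or `L` has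
  -- reached its final size and the test fails from then on.
  refine (Triple.forLoop (m := n) (c := 18) hn (fun i s' => s'.arr = s.arr ∧
      (∀ r, r ≠ 4 → r ≠ 6 → s'.reg r = s.reg r) ∧ s'.reg 4 ≤ i ∧
      (s'.reg 4 = i ∨ 1 ≤ s'.reg 4 ∧ k ≤ s'.reg 4 ∧ 2 * (k : ℝ) ≤ (s'.reg 4 - k) * ε) ∧
      (s'.reg 4 ≤ k + 1 ∨ (s'.reg 4 - 1 - k) * ε ≤ 2 * k)) ?_ ?_ ?_).mono (Nat.mul_le_mul_left _ (by decide)) ?_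
  · refine ⟨rfl, fun r _ h6 => ?_, ?_⟩
    · simp [Config.setReg, h6]
    · simp [Config.setReg, h4]
  · rintro i s' ⟨-, hr, -⟩
    rw [← h0]
    exact hr 0 (by decide) (by decide)
  · rintro i s' hi ⟨ha, hr, hle, hor, hor'⟩ h6
    have hk' : s'.reg 2 = k := by rw [← h2]; exact hr 2 (by decide) (by decide)
    have hε' : s'.arr 2 0 0 = ε := by rw [ha, hε]
    refine (Triple.ite (T := 4) (fun ht => ?_) fun ht => ?_).mono (by decide) fun _ h => h
    · simp only [Test.Holds, RExpr.eval, NExpr.eval, hk', hε', Nat.cast_mul, Nat.cast_ofNat] at ht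
      refine Triple.setReg (e := .add (.reg 4) (.const 1)) ?_
      refine ⟨by simp [Config.setReg, h6], ha, fun r h4 h6 => ?_, ?_⟩
      · simp [Config.setReg, h4, h6, hr r h4 h6]
      · simp only [Config.setReg, NExpr.eval, Function.update_of_ne (by decide : 4 ≠ 6),
          Function.update_self]
        have hi' : s'.reg 4 = i := by
          rcases hor with h | ⟨-, hkl, h⟩
          · exact h
          · rw [Nat.cast_sub hkl] at ht
            exact absurd ht (not_lt.2 h)
        refine ⟨by omega, Or.inl (by omega), ?_⟩
        rcases le_total (s'.reg 4) k with h | h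
        · exact Or.inl (by omega)
        · rw [Nat.cast_sub h] at ht
          right
          push_cast
          rw [add_sub_cancel_right]
          exact ht.le
    · simp only [Test.Holds, RExpr.eval, NExpr.eval, hk', hε', Nat.cast_mul, Nat.cast_ofNat,
        not_lt] at ht
      refine (Triple.skip ⟨h6, ha, fun r h4 h6 => ?_, ?_⟩).mono (by decide) fun _ h => h
      · simp [Config.setReg, h6, hr r h4 h6]
      · simp only [Config.setReg, Function.update_of_ne (by decide : 4 ≠ 6)]
        have hkl : k ≤ s'.reg 4 := by
          by_contra hlt
          rw [Nat.sub_eq_zero_of_le (by omega)] at ht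
          simp only [CharP.cast_eq_zero, zero_mul] at ht
          have : (0 : ℝ) < k := by exact_mod_cast hk
          linarith
        rw [Nat.cast_sub hkl] at ht
        exact ⟨by omega, Or.inr ⟨by omega, hkl, ht⟩, hor'⟩
  · rintro s' ⟨ha, hr, hle, hor, hor'⟩
    exact ⟨ha, hr, by omega, hle, hor.imp_right And.right, hor'⟩

theorem copyHead_spec (hd : 1 ≤ d) (hL : 1 ≤ L) (h1 : s.reg 1 = d) (h4 : s.reg 4 = L) :
    Triple ω copyHead s (L * d * 30) fun s' => (∀ r, r ≠ 6 → r ≠ 7 → s'.reg r = s.reg r) ∧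
      (∀ B ≠ 4, s'.arr B = s.arr B) ∧
      ∀ i < L, rowVec d s'.arr 4 i = rowVec d s.arr 0 i := by
  refine (Triple.fillBlock (i₀ := 0) (f := fun i j => s.arr 0 i j) hL hd
    fun s' i hr hB h6 => ?_).mono (Nat.mul_le_mul_left _ (by decide)) ?_
  · refine ⟨?_, ?_, ?_, fun j h7 _ _ => ?_⟩
    · exact (hr 4 (by decide) (by decide)).trans h4
    · exact (hr 1 (by decide) (by decide)).trans h1
    · simp [NExpr.eval, h6]
    · simp [RExpr.eval, NExpr.eval, h6, h7, hB 0]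
  · rintro s' ⟨hr, ha, -⟩
    refine ⟨hr, fun B hB => ?_, fun i hi => ?_⟩
    · rw [ha]
      funext i j
      simp [setBlock, hB]
    · ext j
      simp [rowVec, ha, setBlock, hi]

theorem copyNext_spec {t : ℕ} (hd : 1 ≤ d) (hL : 1 ≤ L) (h1 : s.reg 1 = d) (h4 : s.reg 4 = L)
    (h5 : s.reg 5 = t) :
    Triple ω copyNext s (L * d * 40) fun s' => (∀ r, r ≠ 6 → r ≠ 7 → s'.reg r = s.reg r) ∧
      (∀ B ≠ 4, s'.arr B = s.arr B) ∧ (∀ i < L, rowVec d s'.arr 4 i = rowVec d s.arr 4 i) ∧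
      ∀ i < L, rowVec d s'.arr 4 (L + i) = rowVec d s.arr 0 (t + i) := by
  refine (Triple.fillBlock (i₀ := L) (f := fun i j => s.arr 0 (t + i) j) hL hd
    fun s' i hr hB h6 => ?_).mono (Nat.mul_le_mul_left _ (by decide)) ?_
  · have h4' := (hr 4 (by decide) (by decide)).trans h4
    have h5' := (hr 5 (by decide) (by decide)).trans h5
    refine ⟨h4', ?_, ?_, fun j h7 _ _ => ?_⟩
    · exact (hr 1 (by decide) (by decide)).trans h1
    · simp [NExpr.eval, h6, h4']
    · simp [RExpr.eval, NExpr.eval, h6, h7, hB 0, h5']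
  · rintro s' ⟨hr, ha, -⟩
    refine ⟨hr, fun B hB => ?_, fun i hi => ?_, fun i hi => ?_⟩
    · rw [ha]
      funext i j
      simp [setBlock, hB]
    · ext j
      simp [rowVec, ha, setBlock, hi.not_ge]
    · ext j
      simp [rowVec, ha, setBlock, hi]

theorem shrink_spec (hd : 1 ≤ d) (hL : 1 ≤ L) (h1 : s.reg 1 = d) (h4 : s.reg 4 = L) :
    Triple ω shrink s (L * d * 50) fun s' => (∀ r, r ≠ 6 → r ≠ 7 → s'.reg r = s.reg r) ∧
      (∀ B ≠ 4, s'.arr B = s.arr B) ∧ ∀ i < L, ∀ j < d, s'.arr 4 i j =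
        √(s.arr 6 0 i ^ 2 - s.arr 6 0 L ^ 2) * s.arr 7 j i := by
  refine (Triple.fillBlock (i₀ := 0) (f := fun i j =>
    √(s.arr 6 0 i ^ 2 - s.arr 6 0 L ^ 2) * s.arr 7 j i) hL hd
    fun s' i hr hB h6 => ?_).mono (Nat.mul_le_mul_left _ (by decide)) ?_
  · have h4' := (hr 4 (by decide) (by decide)).trans h4
    refine ⟨h4', ?_, ?_, fun j h7 _ _ => ?_⟩
    · exact (hr 1 (by decide) (by decide)).trans h1
    · simp [NExpr.eval, h6]
    · simp [valSq, RExpr.eval, NExpr.eval, h6, h7, hB 6, hB 7, h4', sq]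
  · rintro s' ⟨hr, ha, -⟩
    refine ⟨hr, fun B hB => ?_, fun i hi j hj => ?_⟩
    · rw [ha]
      funext i j
      simp [setBlock, hB]
    · simp [ha, setBlock, hi, hj]

/-- When `d ≤ L`, `shrink` reads singular values beyond the `min (L + L) d` that the decomposition
stores. The hypothesis `hz`, which the step preserves, makes those entries zero, as in the continued
`σ`. -/
theorem sketchStep_spec {t : ℕ} {Δ : ℝ} (hd : 1 ≤ d) (hL : 1 ≤ L) (h1 : s.reg 1 = d)
    (h4 : s.reg 4 = L) (h5 : s.reg 5 = t) (hz : ∀ i, min (L + L) d ≤ i → s.arr 6 0 i = 0)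
    (hs : IsSketch (rowVec d s.arr 0) t (rowVec d s.arr 4) L Δ) :
    Triple ω sketchStep s (L * L * d * 110) fun s' =>
      (∀ r, r ≠ 5 → r ≠ 6 → r ≠ 7 → s'.reg r = s.reg r) ∧ s'.reg 5 = t + L ∧
      (∀ B, B = 0 ∨ B = 3 → s'.arr B = s.arr B) ∧
      (∀ i, min (L + L) d ≤ i → s'.arr 6 0 i = 0) ∧
      ∃ Δ, IsSketch (rowVec d s'.arr 0) (t + L) (rowVec d s'.arr 4) L Δ := by
  refine (Triple.seq (copyNext_spec hd hL h1 h4 h5) fun s₁ ⟨hr, hB, hb, hA⟩ =>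
    Triple.seq (T₁ := (L + L) * d * (L + L) + 5)
      (R := fun s' => s' = s₁.svd 4 (L + L) d 5 6 7) ?_ fun s₂ hs₂ =>
    Triple.seq (shrink_spec hd hL (s := s₂) ?_ ?_) fun s₃ ⟨hr', hB', ha⟩ =>
    Triple.setReg (e := .add (.reg 5) (.reg 4)) ?_).mono ?_ fun _ h => h
  · have h4' := (hr 4 (by decide) (by decide)).trans h4
    have h1' := (hr 1 (by decide) (by decide)).trans h1
    refine (Triple.svd ?_).mono ?_ fun _ h => h
    · simp [NExpr.eval, h4', h1']
    · simp only [NExpr.cost, NExpr.eval, h4', h1']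
      have := Nat.mul_le_mul_left ((L + L) * d) (min_le_left (L + L) d)
      omega
  · subst hs₂
    exact (hr 1 (by decide) (by decide)).trans h1
  · subst hs₂
    exact (hr 4 (by decide) (by decide)).trans h4
  · have hreg : s₂.reg = s₁.reg := by subst hs₂; rfl
    obtain ⟨σ, v, hv, hσ, hσ0, hvj, hB₂⟩ := s₁.svd_spec 4 (L + L) d 5 6 7 (by decide) (by decide)
    rw [← hs₂] at hσ hσ0 hvj hB₂
    have hσ' : ∀ i, s₂.arr 6 0 i = σ i := fun i => by
      rcases lt_or_ge i (min (L + L) d) with hi | hi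
      · exact hσ i hi
      · rw [hσ0 i hi, hv.val_eq_zero i hi, hB 6 (by decide), hz i hi]
    have hr'' : ∀ r, r ≠ 6 → r ≠ 7 → s₃.reg r = s.reg r := fun r h6 h7 => by
      rw [hr' r h6 h7, hreg, hr r h6 h7]
    have e0 : s₃.arr 0 = s.arr 0 := by
      rw [hB' 0 (by decide), hB₂ 0 (by decide) (by decide) (by decide), hB 0 (by decide)]
    have e3 : s₃.arr 3 = s.arr 3 := by
      rw [hB' 3 (by decide), hB₂ 3 (by decide) (by decide) (by decide), hB 3 (by decide)]
    have eA : rowVec d s₃.arr 0 = rowVec d s.arr 0 := by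
      funext i; simp only [rowVec, e0]
    refine ⟨fun r h5 h6 h7 => ?_, ?_, ?_, fun i hi => ?_, Δ + σ L ^ 2, ?_⟩
    · simp [Config.setReg, h5, hr'' r h6 h7]
    · simp [Config.setReg, NExpr.eval, hr'', h4, h5]
    · rintro B (rfl | rfl)
      · exact e0
      · exact e3
    · simp only [Config.setReg]
      rw [hB' 6 (by decide), hσ', hv.val_eq_zero i hi]
    · have h := hs.step hb hA hv
      simp only [Config.setReg]
      rw [eA]
      refine h.congr fun i hi => ?_
      ext j
      simp only [rowVec, ha i hi j j.2, hσ', PiLp.smul_apply, smul_eq_mul]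
      rcases lt_or_ge i (min (L + L) d) with hi' | hi'
      · rw [hvj i hi' j]
      -- This column of the array `7` does not hold a singular vector, but its factor is `√(0 - 0)`.
      · have hL' : min (L + L) d ≤ L := hi'.trans hi.le
        simp [hv.val_eq_zero i hi', hv.val_eq_zero L hL']
  · simp only [NExpr.cost]
    have h1 : L * d ≤ L * L * d := by
      rw [mul_assoc]
      exact Nat.le_mul_of_pos_left _ hL
    have h2 : 1 ≤ L * d := Nat.mul_pos hL hd
    nlinarith

/-- At most `n / L` rounds of cost `O(L² d)` give `O(n L d)`. If `L = n`, the head already contains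
all points and no round takes place, whence `Δ = 0`. -/
theorem sketch_spec (hd : 1 ≤ d) (hL : 1 ≤ L) (hLn : L ≤ n) (h0 : s.reg 0 = n) (h1 : s.reg 1 = d)
    (h4 : s.reg 4 = L) (hz : ∀ i, s.arr 6 0 i = 0) (hA : ∀ i, n ≤ i → rowVec d s.arr 0 i = 0) :
    Triple ω sketch s (n * L * d * 160) fun s' =>
      (∀ r, r ≠ 5 → r ≠ 6 → r ≠ 7 → s'.reg r = s.reg r) ∧ s'.arr 0 = s.arr 0 ∧
      ∃ Δ, (L = n → Δ = 0) ∧ IsSketch (rowVec d s'.arr 0) n (rowVec d s'.arr 4) L Δ := by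
  refine (Triple.seq (copyHead_spec hd hL h1 h4) fun s₁ ⟨hr, hB, hb⟩ =>
    Triple.seq (R := fun s' => s' = s₁.setReg 5 L) (Triple.setReg (e := .reg 4) ?_) fun s₂ hs₂ =>
    Triple.whileLoop (J := n / L) (c := L * L * d * 110) (fun j s' =>
      (∀ r, r ≠ 5 → r ≠ 6 → r ≠ 7 → s'.reg r = s.reg r) ∧ s'.reg 5 = (j + 1) * L ∧
      s'.arr 0 = s.arr 0 ∧ (∀ i, min (L + L) d ≤ i → s'.arr 6 0 i = 0) ∧
      ∃ Δ, (L = n → Δ = 0) ∧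
        IsSketch (rowVec d s'.arr 0) (s'.reg 5) (rowVec d s'.arr 4) L Δ) ?_ ?_).mono ?_ ?_
  · simp [NExpr.eval, hr 4, h4]
  · subst hs₂
    refine ⟨fun r h5 h6 h7 => ?_, ?_, ?_, fun i _ => ?_, 0, fun _ => rfl, ?_⟩
    · simp [Config.setReg, h5, hr r h6 h7]
    · simp [Config.setReg]
    · exact hB 0 (by decide)
    · simp [Config.setReg, hB 6, hz]
    · have h5 : (s₁.setReg 5 L).reg 5 = L := by simp [Config.setReg]
      rw [h5]
      refine (IsSketch.refl _ L).congr fun i hi => ?_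
      simp only [Config.setReg]
      rw [hb i hi]
      simp only [rowVec, hB 0 (by decide : 0 ≠ 4)]
  · rintro j s' ⟨hr', h5, ha0, hz', Δ, hΔ, hs⟩ ht
    have ht' : (j + 1) * L < n := by
      have : s'.reg 5 < s'.reg 0 := ht
      rwa [h5, hr' 0 (by decide) (by decide) (by decide), h0] at this
    -- Round `j` starts with `(j + 1) * L < n` points seen, which bounds `j` by `n / L`.
    refine ⟨(Nat.le_div_iff_mul_le hL).2 ht'.le, ?_⟩
    refine (sketchStep_spec hd hL (s := s') ((hr' 1 (by decide) (by decide) (by decide)).trans h1)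
      ((hr' 4 (by decide) (by decide) (by decide)).trans h4) rfl hz' hs).mono le_rfl ?_
    rintro s'' ⟨hr'', h5', hB', hz'', Δ', hs'⟩
    refine ⟨fun r h5 h6 h7 => (hr'' r h5 h6 h7).trans (hr' r h5 h6 h7), ?_,
      (hB' 0 (Or.inl rfl)).trans ha0, hz'', Δ', fun hLn => ?_, ?_⟩
    · rw [h5', h5]; ring
    · exfalso
      have : L ≤ (j + 1) * L := Nat.le_mul_of_pos_left _ (by omega)
      omega
    · rw [h5']; exact hs'
  · have h1 := Nat.div_mul_le_self n L
    have h2 : n / L ≤ n := Nat.div_le_self n L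
    have h3 : n / L * (L * L * d) ≤ n * L * d := by
      calc n / L * (L * L * d) = n / L * L * (L * d) := by ring
        _ ≤ n * (L * d) := Nat.mul_le_mul_right _ h1
        _ = n * L * d := by ring
    have h4 : 1 ≤ L * d := Nat.mul_pos hL hd
    have h5 : n ≤ n * L * d := by
      rw [mul_assoc]
      exact Nat.le_mul_of_pos_right _ h4
    have h6 : L * d ≤ n * L * d := by
      rw [mul_assoc]
      exact Nat.le_mul_of_pos_left _ (hL.trans hLn)
    simp only [NExpr.cost, Test.cost]
    nlinarith
  · rintro s' ⟨ht, j, hr', h5, ha0, hz', Δ, hΔ, hs⟩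
    refine ⟨hr', ha0, Δ, hΔ, hs.of_eq_zero ?_ fun i hi => ?_⟩
    · have : ¬ s'.reg 5 < s'.reg 0 := ht
      rw [hr' 0 (by decide) (by decide) (by decide), h0] at this
      omega
    · rw [← hA i hi]
      simp only [rowVec, ha0]

theorem unitVectors_spec (hk : 1 ≤ k) (hkd : k ≤ d) (h1 : s.reg 1 = d) (h2 : s.reg 2 = k) :
    Triple ω unitVectors s (k * d * 40) fun s' => (∀ r, r ≠ 6 → r ≠ 7 → s'.reg r = s.reg r) ∧
      (∀ B ≠ 3, s'.arr B = s.arr B) ∧ ∀ a < k, ∀ b < k,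
        inner ℝ (rowVec d s'.arr 3 a) (rowVec d s'.arr 3 b) = if a = b then (1 : ℝ) else 0 := by
  -- With truncated subtraction `(i - j) + (j - i)` is `|i - j|`, so this is the Kronecker delta.
  refine (Triple.fillBlock (i₀ := 0) (f := fun i j => ((1 - ((i - j) + (j - i)) : ℕ) : ℝ)) hk
    (hk.trans hkd) fun s' i hr hB h6 => ?_).mono (Nat.mul_le_mul_left _ (by decide)) ?_
  · refine ⟨?_, ?_, ?_, fun j h7 _ _ => ?_⟩
    · exact (hr 2 (by decide) (by decide)).trans h2
    · exact (hr 1 (by decide) (by decide)).trans h1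
    · simp [NExpr.eval, h6]
    · simp [RExpr.eval, NExpr.eval, h6, h7]
  · rintro s' ⟨hr, ha, -⟩
    refine ⟨hr, fun B hB => ?_, fun a hak b hbk => ?_⟩
    · rw [ha]
      funext i j
      simp [setBlock, hB]
    · have key : ∀ a < k, ∀ j < d, s'.arr 3 a j = if j = a then (1 : ℝ) else 0 := by
        intro a hak j hj
        simp only [ha, setBlock, zero_le, zero_add, hak, hj, and_self, if_true, Nat.sub_zero]
        split_ifs with h
        · simp [h]
        · have : 1 - (a - j + (j - a)) = 0 := by omega
          simp [this]
      rw [inner_rowVec, Finset.sum_congr rfl fun j hj => by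
        rw [key a hak j (Finset.mem_range.1 hj), key b hbk j (Finset.mem_range.1 hj)]]
      simp [hbk.trans_le hkd, eq_comm]

/-- The entry `(0, 0)` of the array `12` holds `⟪w, w⟫`, computed once per reflection and shared by
all rows; the entry `(0, 1)` receives `⟪w, x⟫` for the current row `x`. -/
theorem reflectRow_spec {a : ℕ} (hd : 1 ≤ d) (h1 : s.reg 1 = d) (h8 : s.reg 8 = a)
    (hw : s.arr 12 0 0 = inner ℝ (rowVec d s.arr 11 0) (rowVec d s.arr 11 0)) :
    Triple ω reflectRow s (d * 80) fun s' => (∀ r ≠ 7, s'.reg r = s.reg r) ∧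
      (∀ B, B ≠ 3 → B ≠ 12 → s'.arr B = s.arr B) ∧ s'.arr 12 0 0 = s.arr 12 0 0 ∧
      ∀ b, rowVec d s'.arr 3 b = if b = a then
        reflect (rowVec d s.arr 11 0) (rowVec d s.arr 3 b) else rowVec d s.arr 3 b := by
  set w := rowVec d s.arr 11 0 with hw'
  set x := rowVec d s.arr 3 a with hx
  have h₁ : Triple ω (sumRow 7 (.reg 1) 12 1
      (.mul (.entry 11 (.const 0) (.reg 7)) (.entry 3 (.reg 8) (.reg 7)))) s (d * 40)
      (· = { s.setEntry 12 0 1 (inner ℝ w x) with reg := Function.update s.reg 7 d }) := by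
    rw [hw', hx, inner_rowVec]
    refine (Triple.sumRow (f := fun j => s.arr 11 0 j * s.arr 3 a j) hd (fun j y => ?_)
      fun j y hj => ?_).mono (Nat.mul_le_mul_left _ (by decide)) fun _ h => h
    · simp [NExpr.eval, h1]
    · simp [NExpr.eval, RExpr.eval, Config.setEntry, h8]
  refine (h₁.seq (T₂ := d * 40) fun s₁ hs₁ => ?_).mono (T₁ := d * 40 + d * 40) (by omega)
    fun _ h => h
  have r1 : s₁.reg 1 = d := by simp [hs₁, h1]
  have r8 : s₁.reg 8 = a := by simp [hs₁, h8]
  have a0 : s₁.arr 12 0 0 = inner ℝ w w := by simp [hs₁, Config.setEntry, hw]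
  have a1 : s₁.arr 12 0 1 = inner ℝ w x := by simp [hs₁, Config.setEntry]
  have aB : ∀ B ≠ 12, s₁.arr B = s.arr B := fun B hB => by
    funext i j
    simp [hs₁, Config.setEntry, hB]
  refine (Triple.fillRow (m := d) (a := a) (f := fun j => s.arr 3 a j -
    2 * inner ℝ w x / inner ℝ w w * s.arr 11 0 j) hd (fun j => ?_) (fun j => ?_)
    fun j hj => ?_).mono (Nat.mul_le_mul_left _ (by decide)) ?_
  · simp [NExpr.eval, r1]
  · simp [NExpr.eval, r8]
  · simp [NExpr.eval, RExpr.eval, setRow, r8, a0, a1, aB]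
  · rintro _ rfl
    refine ⟨fun r h7 => ?_, fun B h3 h12 => ?_, ?_, fun b => ?_⟩
    · simp [hs₁, h7]
    · funext i j
      simp [setRow, h3, aB B h12]
    · simp [setRow, a0, hw]
    · ext j
      by_cases hb : b = a
      · subst hb
        simp [rowVec, setRow, reflect, hw', hx]
      · simp [rowVec, setRow, hb, aB]

/-- The rows of the array `3` are reflected along `x - v`, where `x` is row `i`. -/
theorem reflectStep_spec {i : ℕ} (hd : 1 ≤ d) (hk : 1 ≤ k) (h1 : s.reg 1 = d) (h2 : s.reg 2 = k)
    (h6 : s.reg 6 = i) {v : EuclideanSpace ℝ (Fin d)} (hv : ∀ j : Fin d, s.arr 10 j i = v j) :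
    Triple ω reflectStep s (k * d * 200) fun s' => (∀ r, r ≠ 7 → r ≠ 8 → s'.reg r = s.reg r) ∧
      s'.arr 10 = s.arr 10 ∧ ∀ b < k, rowVec d s'.arr 3 b =
        reflect (rowVec d s.arr 3 i - v) (rowVec d s.arr 3 b) := by
  set w := rowVec d s.arr 3 i - v with hw
  -- The vector `w` gets an array of its own because row `i`, from which it is formed, is itself
  -- overwritten by the reflection.
  have h₁ : Triple ω (fillRow 7 (.reg 1) 11 (.const 0)
      (.sub (.entry 3 (.reg 6) (.reg 7)) (.entry 10 (.reg 7) (.reg 6)))) s (d * 40) fun s' =>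
        (∀ r, r ≠ 7 → s'.reg r = s.reg r) ∧ (∀ B ≠ 11, s'.arr B = s.arr B) ∧
          rowVec d s'.arr 11 0 = w := by
    refine (Triple.fillRow (m := d) (a := 0) (f := fun j => s.arr 3 i j - s.arr 10 j i) hd
      (fun j => ?_) (fun j => ?_) fun j hj => ?_).mono (Nat.mul_le_mul_left _ (by decide)) ?_
    · simp [NExpr.eval, h1]
    · simp [NExpr.eval]
    · simp [NExpr.eval, RExpr.eval, setRow, h6]
    · rintro _ rfl
      refine ⟨fun r h7 => by simp [h7], fun B hB => ?_, ?_⟩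
      · funext i' j
        simp [setRow, hB]
      · ext j
        simp [rowVec, setRow, hw, hv]
  have h₂ : ∀ s₁ : Config, s₁.reg 1 = d → rowVec d s₁.arr 11 0 = w →
      Triple ω (sumRow 7 (.reg 1) 12 0
        (.mul (.entry 11 (.const 0) (.reg 7)) (.entry 11 (.const 0) (.reg 7)))) s₁ (d * 40)
      (· = { s₁.setEntry 12 0 0 (inner ℝ w w) with reg := Function.update s₁.reg 7 d }) := by
    intro s₁ r1 hw₁
    rw [← hw₁, inner_rowVec]
    refine (Triple.sumRow (f := fun j => s₁.arr 11 0 j * s₁.arr 11 0 j) hd (fun j y => ?_)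
      fun j y hj => ?_).mono (Nat.mul_le_mul_left _ (by decide)) fun _ h => h
    · simp [NExpr.eval, r1]
    · simp [NExpr.eval, RExpr.eval, Config.setEntry]
  refine (h₁.seq fun s₁ ⟨hr₁, hB₁, hw₁⟩ => (h₂ s₁ (by rw [hr₁ 1 (by decide), h1]) hw₁).seq
    (T₂ := k * (d * 80 + 12)) fun s₂ hs₂ => ?_).mono ?_ fun _ h => h
  · have hr₂ : ∀ r ≠ 7, s₂.reg r = s.reg r := fun r h7 => by simp [hs₂, h7, hr₁]
    have hB₂ : ∀ B ≠ 12, s₂.arr B = s₁.arr B := fun B hB => by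
      funext i j
      simp [hs₂, Config.setEntry, hB]
    refine (Triple.forLoop (m := k) (c := d * 80) hk (fun a s' =>
      (∀ r, r ≠ 7 → r ≠ 8 → s'.reg r = s.reg r) ∧
      (s'.arr 10 = s.arr 10 ∧ rowVec d s'.arr 11 0 = w) ∧ s'.arr 12 0 0 = inner ℝ w w ∧
      ∀ b, rowVec d s'.arr 3 b = if b < a then reflect w (rowVec d s.arr 3 b) else
        rowVec d s.arr 3 b) ?_ ?_ ?_).mono (Nat.mul_le_mul_left _ (by simp [NExpr.cost])) ?_
    · refine ⟨fun r h7 h8 => ?_, ⟨?_, ?_⟩, ?_, fun b => ?_⟩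
      · simp [Config.setReg, h8, hr₂ r h7]
      · simp only [Config.setReg]
        rw [hB₂ 10 (by decide), hB₁ 10 (by decide)]
      · rw [← hw₁]
        simp only [Config.setReg, rowVec, hB₂ 11 (by decide)]
      · simp [Config.setReg, hs₂, Config.setEntry]
      · simp only [Config.setReg, rowVec, hB₂ 3 (by decide), hB₁ 3 (by decide), not_lt_zero,
          if_false]
    · rintro a s' ⟨hr, -⟩
      exact (hr 2 (by decide) (by decide)).trans h2
    · rintro a s' ha ⟨hr, ⟨h10, h11⟩, h12, h3⟩ h8
      refine (reflectRow_spec (s := s') hd ((hr 1 (by decide) (by decide)).trans h1) h8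
        (by rw [h11, h12])).mono le_rfl ?_
      rintro s'' ⟨hr', hB', h12', h3'⟩
      refine ⟨(hr' 8 (by decide)).trans h8, fun r h7 h8 => ?_, ⟨?_, ?_⟩, ?_, fun b => ?_⟩
      · simp [Config.setReg, h8, hr' r h7, hr r h7 h8]
      · exact (hB' 10 (by decide) (by decide)).trans h10
      · rw [← h11]
        simp only [Config.setReg, rowVec, hB' 11 (by decide) (by decide)]
      · exact h12'.trans h12
      · simp only [Config.setReg]
        rw [h3', h11, h3]
        rcases lt_trichotomy b a with h | h | h
        · simp [h, h.ne, Nat.lt_succ_of_lt h]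
        · simp [h]
        · have h5 : ¬ b < a + 1 := by omega
          simp [h.ne', h.not_gt, h5]
    · rintro s' ⟨hr, ⟨h10, -⟩, -, h3⟩
      exact ⟨hr, h10, fun b hb => by rw [h3, if_pos hb]⟩
  · have : 1 * d ≤ k * d := Nat.mul_le_mul_right d hk
    have : k * 1 ≤ k * d := Nat.mul_le_mul_left k hd
    nlinarith

/-- Reflections keep all `k` rows orthonormal. The one along `x i - v i` moves row `i` to `v i` and
fixes each earlier row `v a`, which is orthogonal to both `x i` and `v i`. Only `min n k`
reflections are needed, each of cost `O(k d)`, so the total is `O(n k d)`. -/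
theorem complete_spec (hn : 1 ≤ n) (hk : 1 ≤ k) (hkd : k ≤ d) (h0 : s.reg 0 = n) (h1 : s.reg 1 = d)
    (h2 : s.reg 2 = k) {v : ℕ → EuclideanSpace ℝ (Fin d)}
    (hv : ∀ i < min n k, ∀ j : Fin d, s.arr 10 j i = v i j)
    (ho : ∀ i < min n k, ∀ j < min n k, inner ℝ (v i) (v j) = if i = j then (1 : ℝ) else 0) :
    Triple ω complete s (n * k * d * 260) fun s' =>
      (∀ a < k, ∀ b < k,
        inner ℝ (rowVec d s'.arr 3 a) (rowVec d s'.arr 3 b) = if a = b then (1 : ℝ) else 0) ∧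
      ∀ i < min n k, rowVec d s'.arr 3 i = v i := by
  have hd := hk.trans hkd
  have hm : 1 ≤ min n k := le_min hn hk
  refine (Triple.seq (unitVectors_spec hk hkd h1 h2) fun s₁ ⟨hr₁, hB₁, ho₁⟩ => Triple.forLoop
    (c := k * d * 200) hm (fun i s' =>
      (∀ r, r ≠ 6 → r ≠ 7 → r ≠ 8 → s'.reg r = s.reg r) ∧ s'.arr 10 = s.arr 10 ∧
      (∀ a < k, ∀ b < k,
        inner ℝ (rowVec d s'.arr 3 a) (rowVec d s'.arr 3 b) = if a = b then (1 : ℝ) else 0) ∧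
      ∀ a < i, rowVec d s'.arr 3 a = v a) ?_ ?_ ?_).mono ?_ fun s' hs' => hs'.2.2
  · exact ⟨fun r h6 h7 _ => by simp [Config.setReg, h6, hr₁ r h6 h7], hB₁ 10 (by decide), ho₁,
      fun a ha => absurd ha (Nat.not_lt_zero a)⟩
  · rintro i s' ⟨hr, -⟩
    have e0 := (hr 0 (by decide) (by decide) (by decide)).trans h0
    have e2 := (hr 2 (by decide) (by decide) (by decide)).trans h2
    -- `n - (n - k) = min n k` for truncated subtraction.
    simp only [NExpr.eval, e0, e2]
    omega
  · rintro i s' hi ⟨hr, h10, ho', hx⟩ h6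
    refine (reflectStep_spec (s := s') hd hk ((hr 1 (by decide) (by decide) (by decide)).trans h1)
      ((hr 2 (by decide) (by decide) (by decide)).trans h2) h6
      (v := v i) (fun j => by rw [h10, hv i hi j])).mono le_rfl ?_
    rintro s'' ⟨hr', h10', h3'⟩
    have hik : i < k := hi.trans_le (min_le_right _ _)
    refine ⟨(hr' 6 (by decide) (by decide)).trans h6, fun r h6 h7 h8 => ?_, h10'.trans h10,
      fun a ha b hb => ?_, fun a ha => ?_⟩
    · simp [Config.setReg, h6, hr' r h7 h8, hr r h6 h7 h8]
    · simp only [Config.setReg]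
      rw [h3' a ha, h3' b hb, inner_reflect, ho' a ha b hb]
    · simp only [Config.setReg]
      have hai : a ≤ i := Nat.lt_succ_iff.1 ha
      rw [h3' a (hai.trans_lt hik)]
      rcases hai.eq_or_lt with rfl | hlt
      · exact reflect_sub (by rw [ho' a hik a hik, if_pos rfl]) (by rw [ho a hi a hi, if_pos rfl])
      · have hxa := hx a hlt
        have h0 : inner ℝ (rowVec d s'.arr 3 i - v i) (rowVec d s'.arr 3 a) = (0 : ℝ) := by
          rw [inner_sub_left, ho' i hik a (hlt.trans hik), hxa, ho i hi a (hlt.trans hi)]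
          exact sub_self _
        rw [reflect, h0, hxa]
        simp
  · have h3 : 1 ≤ k * d := Nat.mul_pos hk hd
    have h4 : min n k * (k * d) ≤ n * (k * d) := Nat.mul_le_mul_right _ (min_le_left _ _)
    have h5 : min n k ≤ n * (k * d) :=
      (min_le_left _ _).trans (Nat.le_mul_of_pos_right _ h3)
    have h6 : k * d ≤ n * (k * d) := Nat.le_mul_of_pos_left _ hn
    simp only [NExpr.cost]
    nlinarith

end FrequentDirections

/-! ### Correctness and running time of the whole program -/

namespace FrequentDirections

variable {n d k u : ℕ} {P : Fin n → EuclideanSpace ℝ (Fin d)} {B : Fin u → EuclideanSpace ℝ (Fin d)}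
  {ε δ : ℝ}

theorem rowVec_inputConfig (i : Fin n) : rowVec d (inputConfig k P B ε δ).arr 0 i = P i := by
  ext j
  simp [rowVec, inputConfig, putMatrix]

theorem rowVec_inputConfig_of_le {i : ℕ} (hi : n ≤ i) :
    rowVec d (inputConfig k P B ε δ).arr 0 i = 0 := by
  ext j
  simp [rowVec, inputConfig, putMatrix, not_lt.2 hi]

/-- The algorithm computes an orthonormal basis of a nearly optimal flat. -/
theorem program_spec (ω : Tape) (hn : 1 ≤ n) (hk : 1 ≤ k) (hkd : k ≤ d) (hε : 0 < ε) :
    ∃ (L T : ℕ) (s : Config), (L ≤ k + 1 ∨ ((L : ℝ) - 1 - k) * ε ≤ 2 * k) ∧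
      T ≤ n * (L + k) * d * 500 ∧ Exec ω program (inputConfig k P B ε δ) T s ∧
      IsFlat k (outputFlat k d s) ∧ ∀ W, IsFlat k W →
        price P (outputFlat k d s) ≤ (1 + ε / 2) * price P W := by
  have hd := hk.trans hkd
  obtain ⟨T₁, hT₁, s₁, he₁, ha₁, hr₁, hL, hLn, hLε, hLb⟩ :=
    sketchSize_spec (ω := ω) (s := inputConfig k P B ε δ) (n := n) (k := k) (ε := ε) hn hk
      (by simp [inputConfig]) (by simp [inputConfig]) (by simp [inputConfig])
      (by simp [inputConfig, putMatrix])
  have r0 : s₁.reg 0 = n := (hr₁ 0 (by decide) (by decide)).trans (by simp [inputConfig])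
  have r1 : s₁.reg 1 = d := (hr₁ 1 (by decide) (by decide)).trans (by simp [inputConfig])
  have r2 : s₁.reg 2 = k := (hr₁ 2 (by decide) (by decide)).trans (by simp [inputConfig])
  obtain ⟨L, r4⟩ : ∃ L, s₁.reg 4 = L := ⟨_, rfl⟩
  rw [r4] at hL hLn hLε hLb
  have rest : Triple ω (.seq sketch (.seq (.svd 4 (.reg 4) (.reg 1) 8 9 10) complete)) s₁
      (n * L * d * 160 + (n * L * d + 3 + n * k * d * 260)) fun s =>
        IsFlat k (outputFlat k d s) ∧ ∀ W, IsFlat k W →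
          price P (outputFlat k d s) ≤ (1 + ε / 2) * price P W := by
    refine (sketch_spec hd hL hLn r0 r1 r4 (fun i => ?_) fun i hi => ?_).seq
      fun s₂ ⟨hr₂, ha₂, Δ, hΔ, hs⟩ => ?_
    · rw [ha₁]
      simp [inputConfig, putMatrix]
    · rw [ha₁]
      exact rowVec_inputConfig_of_le hi
    have r0' := (hr₂ 0 (by decide) (by decide) (by decide)).trans r0
    have r1' := (hr₂ 1 (by decide) (by decide) (by decide)).trans r1
    have r2' := (hr₂ 2 (by decide) (by decide) (by decide)).trans r2
    have r4' := (hr₂ 4 (by decide) (by decide) (by decide)).trans r4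
    refine Triple.seq (R := (· = s₂.svd 4 L d 8 9 10)) ?_ fun s₃ hs₃ => ?_
    · refine (Triple.svd ?_).mono ?_ fun _ h => h
      · simp [NExpr.eval, r1', r4']
      · simp only [NExpr.cost, NExpr.eval, r1', r4']
        have := Nat.mul_le_mul_left (L * d) ((min_le_left L d).trans hLn)
        have e : L * d * n = n * L * d := by ring
        omega
    · obtain ⟨σ, v, hv, -, -, hvj, -⟩ := s₂.svd_spec 4 L d 8 9 10 (by decide) (by decide)
      rw [← hs₃] at hvj
      have hreg : s₃.reg = s₂.reg := by rw [hs₃]; rfl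
      have hmL : min n k ≤ min L d := by
        rcases hLε with h | h
        · omega
        · omega
      refine (complete_spec hn hk hkd (by rw [hreg, r0']) (by rw [hreg, r1']) (by rw [hreg, r2'])
        (v := v) (fun i hi => hvj i (hi.trans_le hmL)) fun i hi j hj =>
          hv.orthonormal i (hi.trans_le hmL) j (hj.trans_le hmL)).mono le_rfl ?_
      rintro s ⟨ho, hx⟩
      have ho' : Orthonormal ℝ fun i : Fin k => rowVec d s.arr 3 i := by
        rw [orthonormal_iff_ite]
        intro i j
        rw [ho i i.2 j j.2]
        simp [Fin.ext_iff]
      refine ⟨?_, fun W hW => ?_⟩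
      · exact (finrank_span_eq_card ho'.linearIndependent).trans (Fintype.card_fin k)
      · refine price_le_of_isSketch (m := min n k) (fun i => ?_) hs hv (min_le_right _ _) hmL ?_ hx
          ho' hε ?_ hW
        · have : rowVec d s₂.arr 0 i = rowVec d (inputConfig k P B ε δ).arr 0 i := by
            simp only [rowVec, ha₂, ha₁]
          rw [this, rowVec_inputConfig]
        -- If `n < k`, then `min L d ≤ L ≤ n`: all possibly nonzero singular values of the sketch
        -- are covered, and the completing vectors may be arbitrary.
        · omega
        · exact hLε.imp hΔ And.right
  obtain ⟨T₂, hT₂, s, he₂, hs⟩ := rest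
  refine ⟨L, T₁ + T₂, s, hLb, ?_, .seq he₁ he₂, hs⟩
  have h1 : 1 ≤ n * d := Nat.mul_pos hn hd
  have h2 : n * d ≤ n * d * L := Nat.le_mul_of_pos_right _ hL
  have h3 : n ≤ n * d := Nat.le_mul_of_pos_right _ hd
  nlinarith

end FrequentDirections

/-! ### The main theorem -/

theorem mainTheorem4 :
    ∃ prog : Prog, ∀ c : ℕ, ∃ C : ℝ, 0 < C ∧
      ∀ (n d k u : ℕ), 1 ≤ n → 1 ≤ k → k ≤ d → u ≤ c * k →
      ∀ (P : Fin n → EuclideanSpace ℝ (Fin d))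
        (F : Submodule ℝ (EuclideanSpace ℝ (Fin d))) (B : Module.Basis (Fin u) ℝ F)
        (ε δ : ℝ), 0 < ε → 0 < δ →
      ∃ out : Tape → Config,
        (∀ ω, ∃ T : ℕ,
          Exec ω prog (inputConfig k P (fun i => (B i : EuclideanSpace ℝ (Fin d))) ε δ) T (out ω) ∧
          (T : ℝ) ≤ C * ((n * d : ℕ) : ℝ) * (k / min ε 1) * Real.log (1 / min δ (1 / 2))) ∧
        (∀ ω, IsFlat k (outputFlat k d (out ω))) ∧
        MeasurableSet {ω | price P (outputFlat k d (out ω)) ≤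
          (1 + ε / 2) * optPrice P k + ε / 2 * price P F} ∧
        ENNReal.ofReal (1 - δ) ≤ tapeMeasure {ω | price P (outputFlat k d (out ω)) ≤
          (1 + ε / 2) * optPrice P k + ε / 2 * price P F} := by
  refine ⟨FrequentDirections.program, fun c => ⟨5000, by norm_num, ?_⟩⟩
  intro n d k u hn hk hkd _ P F B ε δ hε hδ
  choose L T out hL hT hexec hflat hprice using fun ω => FrequentDirections.program_spec (P := P)
    (B := fun i => (B i : EuclideanSpace ℝ (Fin d))) (δ := δ) ω hn hk hkd hε
  have huniv : {ω | price P (outputFlat k d (out ω)) ≤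
      (1 + ε / 2) * optPrice P k + ε / 2 * price P F} = Set.univ := by
    refine Set.eq_univ_of_forall fun ω => ?_
    have hF : 0 ≤ price P F := Finset.sum_nonneg fun _ _ => sq_nonneg _
    have hpos : 0 < 1 + ε / 2 := by positivity
    -- Comparison with every flat bounds the infimum, so no minimizer is needed; the computed flat
    -- shows that the set of prices is nonempty.
    have h : price P (outputFlat k d (out ω)) / (1 + ε / 2) ≤ optPrice P k := by
      refine le_csInf ⟨_, _, hflat ω, rfl⟩ ?_
      rintro _ ⟨W, hW, rfl⟩
      exact (div_le_iff₀' hpos).2 (hprice ω W hW)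
    have h' := (div_le_iff₀' hpos).1 h
    have : 0 ≤ ε / 2 * price P F := by positivity
    rw [Set.mem_ofPred_eq]
    linarith
  refine ⟨out, fun ω => ⟨T ω, hexec ω, ?_⟩, hflat, ?_, ?_⟩
  · have he : 0 < min ε 1 := lt_min hε one_pos
    have hk0 : (1 : ℝ) ≤ k := by exact_mod_cast hk
    set κ : ℝ := k / min ε 1 with hκ
    have hκk : (k : ℝ) ≤ κ := (le_div_iff₀ he).2 (by nlinarith [min_le_right ε 1])
    have hκε : 2 * (k : ℝ) ≤ 2 * κ * ε := by
      have : (k : ℝ) = κ * min ε 1 := by rw [hκ]; field_simp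
      nlinarith [min_le_left ε 1]
    -- Either `L ≤ k + 1 ≤ 2 κ`, or `L ≤ 1 + k + 2 κ ≤ 4 κ`. Then `L + k ≤ 5 κ`, and `5000 = 500 * 5
    -- * 2`, where the `2` pays for the lower bound `1 / 2` of the logarithm.
    have hLκ : (L ω : ℝ) ≤ 4 * κ := by
      rcases hL ω with h | h
      · have : (L ω : ℝ) ≤ k + 1 := by exact_mod_cast h
        linarith
      · have := le_of_mul_le_mul_right (h.trans hκε) hε
        linarith
    have hlog : (1 : ℝ) / 2 ≤ Real.log (1 / min δ (1 / 2)) := by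
      have h2 : (2 : ℝ) ≤ 1 / min δ (1 / 2) := by
        rw [le_div_iff₀ (lt_min hδ (by norm_num))]
        linarith [min_le_right δ (1 / 2)]
      have := Real.log_le_log two_pos h2
      linarith [Real.log_two_gt_d9]
    have hT' : (T ω : ℝ) ≤ n * (L ω + k) * d * 500 := by exact_mod_cast hT ω
    have hN : (0 : ℝ) ≤ ((n * d : ℕ) : ℝ) := Nat.cast_nonneg _
    calc (T ω : ℝ) ≤ n * (L ω + k) * d * 500 := hT'
      _ = ((n * d : ℕ) : ℝ) * (L ω + k) * 500 := by push_cast; ring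
      _ ≤ ((n * d : ℕ) : ℝ) * (5 * κ) * 500 := by gcongr; linarith
      _ = 5000 * ((n * d : ℕ) : ℝ) * κ * (1 / 2) := by ring
      _ ≤ 5000 * ((n * d : ℕ) : ℝ) * κ * Real.log (1 / min δ (1 / 2)) := by
        have : 0 ≤ κ := by linarith
        gcongr
  · rw [huniv]
    exact MeasurableSet.univ
  · rw [huniv]
    have : IsProbabilityMeasure tapeMeasure := by unfold tapeMeasure; infer_instance
    rw [measure_univ]
    exact ENNReal.ofReal_le_one.2 (by linarith)
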